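/- Let $X_1=\{X_1(t)\}_{t\in[0,1]}$ and $X_2=\{X_2(t)\}_{t\in[0,1]}$ be independent centered Gaussian processes with (almost surely) continuous paths, with $X_1(0)=X_2(0)=0$ almost surely, and with covariance functions $R_1,R_2$. *Notation.* For $h:[0,1]^2\to\mathbb R$ write $\Delta h(s,t;u,v):=h(t,v)-h(t,u)-h(s,v)+h(s,u)$ for the rectangular increment over $[s,t]\times[u,v]$. For $p\ge1$, $h$ has finite $p$-variation if $$V_p(h)=\sup_{D,D'}\Big(\sum_{i,j}\big|\Delta h(t_i,t_{i+1};t'_j,t'_{j+1})\big|^p\Big)^{1/p}<\infty ,$$ the supremum being over pairs of partitions $D=\{t_i\}$, $D'=\{t'_j\}$ of $[0,1]$. The Riemann–Stieltjes integral $\iint_{[0,1]^2} h\,dR$ is the limit, as the meshes of $D$ and $D'$ tend to $0$, of the sums $\sum_{i,j}h(\xi_i,\eta_j)\,\Delta R(t_i,t_{i+1};t'_j,t'_{j+1})$ with arbitrary $\xi_i\in[t_i,t_{i+1}]$, $\eta_j\in[t'_j,t'_{j+1}]$. Let $\mathcal E$ be the space of step functions on $[0,1]$, i.e. the linear span of the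 functions $\mathbf 1_{(a,b]}$, and let $\mathcal E_2$ be the space of functions $f$ on $[0,1]\times\{1,2\}$ with $f(\cdot,1),f(\cdot,2)\in\mathcal E$. Let $H$ be the Hilbert space obtained by completing $\mathcal E_2$ (after identifying elements at distance $0$) for the inner product $$\langle f,g\rangle=\sum_{i=1}^2\iint_{[0,1]^2} f(s,i)g(t,i)\,dR_i(s,t),$$ where $dR_i$ gives the rectangle $(a,b]\times(c,d]$ the mass $\Delta R_i(a,b;c,d)$. Let $H^{\otimes2}$ be the Hilbert tensor square of $H$ and $H^{\odot2}\subseteq H^{\otimes 2}$ the closed linear span of the tensors $h\otimes h$, $h\in H$. An element $g$ of the algebraic tensor product $\mathcal E_2\otimes\mathcal E_2$ is identified with the step function $g_{ij}(s,t)=g((s,i),(t,j))$, where $f\otimes f'$ is the function $f(s,i)f'(t,j)$. The Lévy kernel is $f^{\mathcal L}_{11}=f^{\mathcal L}_{22}=0$, $f^{\mathcal L}_{12}(s,t)=\frac12(\mathbf 1_{s<t}-\mathbf 1_{s>t})$, $f^{\mathcal L}_{21}=-f^{\mathcal L}_{12}$. With $I_k^n=(k2^{-n},(k+1)2^{-n}]$,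 $T_1^n=\bigcup_{k<l}I_k^n\times I_l^n$, $T_2^n=\bigcup_{k>l}I_k^n\times I_l^n$ ($0\le k,l<2^n$), its dyadic approximation $f_n\in\mathcal E_2\otimes\mathcal E_2$ is $(f_n)_{11}=(f_n)_{22}=0$, $(f_n)_{12}=\frac12(\mathbf 1_{T_1^n}-\mathbf 1_{T_2^n})$, $(f_n)_{21}=-(f_n)_{12}$. For $f\in\mathcal E_2$ put $X(f)=\int f(t,1)\,dX_1(t)+\int f(t,2)\,dX_2(t)$ (finite sums of increments). The double Wiener–Itô integral $I_2$ is the linear map given on $\mathcal E_2\otimes\mathcal E_2$ by $I_2(f\otimes g)=X(f)X(g)-\langle f,g\rangle$ and extended by continuity, from the norm of $H^{\otimes2}$ to that of $L^2$. *Theorem.* Suppose that $R_1$ has finite $p$-variation and $R_2$ has finite $q$-variation, where $p,q\ge1$ and $\frac1p+\frac1q>1$. Then $(f_n)$ is a Cauchy sequence in $H^{\otimes2}$. Its limit $\hat f^{\mathcal L}$ belongs to $H^{\odot2}$, and for every step function $g\in\mathcal E_2\otimes\mathcal E_2$ the iterated Riemann–Stieltjes integrals below exist and $$\langle\hat f^{\mathcal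 L},g\rangle_{H^{\otimes2}}=\sum_{i,j=1}^2\iint_{[0,1]^2}\Big(\iint_{[0,1]^2}f^{\mathcal L}_{ij}(s,u)\,g_{ij}(t,v)\,dR_i(s,t)\Big)dR_j(u,v).$$ Consequently the generalised Lévy area $I_2(f^{\mathcal L}):=I_2(\hat f^{\mathcal L})$ exists as a square integrable random variable. -/

import Mathlib

open MeasureTheory ProbabilityTheory Filter Topology
open scoped unitInterval TensorProduct ENNReal

noncomputable section

namespace LevyArea

/-! ### Rectangular increments, partitions, `p`-variation, Riemann–Stieltjes integrals -/

/-- The rectangular increment of `f` over `[s, t] × [u, v]`. -/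
def rect (f : I → I → ℝ) (s t u v : I) : ℝ := f t v - f t u - f s v + f s u

/-- A partition `0 = t₀ < t₁ < ⋯ < tₙ = 1` of `[0, 1]`. -/
structure Partition where
  n : ℕ
  pt : Fin (n + 1) → I
  strictMono : StrictMono pt
  pt_zero : pt 0 = 0
  pt_last : pt (Fin.last n) = 1

/-- The rectangular increment of `f` over the `(i, j)`-th cell of the grid `D × D'`. -/
def Partition.cell (D D' : Partition) (f : I → I → ℝ) (i : Fin D.n) (j : Fin D'.n) : ℝ :=
  rect f (D.pt i.castSucc) (D.pt i.succ) (D'.pt j.castSucc) (D'.pt j.succ)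

/-- All the intervals of the partition are shorter than `δ`. -/
def Partition.MeshLT (D : Partition) (δ : ℝ) : Prop :=
  ∀ i : Fin D.n, (D.pt i.succ : ℝ) - (D.pt i.castSucc : ℝ) < δ

/-- `ξ` chooses a point in every interval of the partition. -/
def Partition.IsTag (D : Partition) (ξ : Fin D.n → I) : Prop :=
  ∀ i : Fin D.n, ξ i ∈ Set.Icc (D.pt i.castSucc) (D.pt i.succ)

/-- The two-dimensional `p`-variation of `f` over `[0, 1]²`. -/
def pVariation (f : I → I → ℝ) (p : ℝ) : ℝ≥0∞ :=
  ⨆ (D : Partition) (D' : Partition),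
    (∑ i : Fin D.n, ∑ j : Fin D'.n, ‖D.cell D' f i j‖ₑ ^ p) ^ (1 / p)

/-- The Riemann–Stieltjes integral `∬_{[0,1]²} f dg` exists and equals `c`: the sums over tagged
grids converge to `c` as both meshes tend to zero. -/
def HasRSIntegral (f g : I → I → ℝ) (c : ℝ) : Prop :=
  ∀ ε > 0, ∃ δ > 0, ∀ D D' : Partition, D.MeshLT δ → D'.MeshLT δ →
    ∀ (ξ : Fin D.n → I) (η : Fin D'.n → I), D.IsTag ξ → D'.IsTag η →
      |∑ i : Fin D.n, ∑ j : Fin D'.n, f (ξ i) (η j) * D.cell D' g i j - c| < ε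

/-- The iterated Riemann–Stieltjes integral
`∬ (∬ k(s, t, u, v) dR(s, t)) dR'(u, v)` exists and equals `c`. -/
def HasIteratedRSIntegral (k : I → I → I → I → ℝ) (R R' : I → I → ℝ) (c : ℝ) : Prop :=
  ∃ F : I → I → ℝ,
    (∀ u v : I, HasRSIntegral (fun s t => k s t u v) R (F u v)) ∧ HasRSIntegral F R' c

/-! ### Step functions and their elementary integrals -/

/-- The indicator function of `(a, b]`. -/
def ioc (a b : I) : I → ℝ := (Set.Ioc a b).indicator 1

/-- The step functions on `[0, 1]`: finite linear combinations of indicators of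
intervals `(a, b]`. -/
def StepFun : Submodule ℝ (I → ℝ) := Submodule.span ℝ (Set.range fun x : I × I => ioc x.1 x.2)

/-- The indicator of `(a, b]` as a step function. -/
def stepInd (a b : I) : StepFun := ⟨ioc a b, Submodule.subset_span ⟨(a, b), rfl⟩⟩

/-- The indicators of the intervals `(0, t]`, `0 < t ≤ 1`. -/
def iocBasis (t : {t : I // 0 < t}) : I → ℝ := ioc 0 t.1

lemma ioc_eq_sub {a b : I} (h : a ≤ b) : ioc a b = ioc 0 b - ioc 0 a := by
  funext x
  have h1 : (0 : I) ≤ a := unitInterval.nonneg'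
  simp only [ioc, Set.indicator_apply, Set.mem_Ioc, Pi.one_apply, Pi.sub_apply]
  split_ifs <;> grind

lemma linearIndependent_iocBasis : LinearIndependent ℝ iocBasis := by
  classical
  rw [linearIndependent_iff']
  intro s g hg
  by_contra! hne
  obtain ⟨i₀, hi₀, hgi₀⟩ := hne
  obtain ⟨m, hm, hmax⟩ := (s.filter fun i => g i ≠ 0).exists_max_image id
    ⟨i₀, Finset.mem_filter.2 ⟨hi₀, hgi₀⟩⟩
  rw [Finset.mem_filter] at hm
  have h := congrFun hg m.1
  rw [Finset.sum_apply, Finset.sum_eq_single m] at h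
  · simp only [Pi.smul_apply, iocBasis, ioc, Set.indicator_apply, Set.mem_Ioc, m.2, le_refl,
      and_self, if_true, Pi.one_apply, smul_eq_mul, mul_one, Pi.zero_apply] at h
    exact hm.2 h
  · intro b hb hbm
    by_cases hgb : g b = 0
    · simp [hgb]
    · have hlt : b < m := lt_of_le_of_ne (hmax b (Finset.mem_filter.2 ⟨hb, hgb⟩)) hbm
      have hlt' : ¬ m.1 ≤ b.1 := not_le.2 hlt
      simp [iocBasis, ioc, hlt']
  · intro hms
    exact absurd hm.1 hms

lemma stepFun_eq : StepFun = Submodule.span ℝ (Set.range iocBasis) := by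
  have h0 : ∀ b : I, ioc 0 b ∈ Submodule.span ℝ (Set.range iocBasis) := by
    intro b
    by_cases hb : 0 < b
    · exact Submodule.subset_span ⟨⟨b, hb⟩, rfl⟩
    · have : ioc 0 b = 0 := by
        rw [ioc, Set.Ioc_eq_empty hb, Set.indicator_empty']
      rw [this]
      exact Submodule.zero_mem _
  apply le_antisymm
  · refine Submodule.span_le.2 ?_
    rintro _ ⟨⟨a, b⟩, rfl⟩
    rcases le_total a b with h | h
    · change ioc a b ∈ _
      rw [ioc_eq_sub h]
      exact Submodule.sub_mem _ (h0 b) (h0 a)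
    · change ioc a b ∈ _
      have : ioc a b = 0 := by
        rw [ioc, Set.Ioc_eq_empty (not_lt.2 h), Set.indicator_empty']
      rw [this]
      exact Submodule.zero_mem _
  · refine Submodule.span_le.2 ?_
    rintro _ ⟨t, rfl⟩
    exact Submodule.subset_span ⟨(0, t.1), rfl⟩

/-- The coefficients of a step function in the basis of indicators of `(0, t]`, `0 < t ≤ 1`. -/
def stepCoeff : StepFun →ₗ[ℝ] ({t : I // 0 < t} →₀ ℝ) :=
  linearIndependent_iocBasis.repr ∘ₗ (LinearEquiv.ofEq _ _ stepFun_eq).toLinearMap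

/-- The elementary integral `∫ φ dG` of a step function `φ` against a vector-valued function `G`:
the linear map on step functions which sends the indicator of `(a, b]` to `G b - G a`. -/
def stepInt {V : Type*} [AddCommGroup V] [Module ℝ V] (G : I → V) : StepFun →ₗ[ℝ] V :=
  Finsupp.linearCombination ℝ (fun t : {t : I // 0 < t} => G t.1 - G 0) ∘ₗ stepCoeff

lemma stepInt_zero_left {V : Type*} [AddCommGroup V] [Module ℝ V] (G : I → V) (b : I) :
    stepInt G (stepInd 0 b) = G b - G 0 := by
  by_cases hb : 0 < b
  · have h : stepCoeff (stepInd 0 b) = Finsupp.single ⟨b, hb⟩ 1 :=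
      linearIndependent_iocBasis.repr_eq_single ⟨b, hb⟩ _ rfl
    simp [stepInt, h]
  · have h0 : b = 0 := le_antisymm (not_lt.1 hb) unitInterval.nonneg'
    subst h0
    have h : stepInd 0 0 = 0 := by
      apply Subtype.ext
      change ioc 0 0 = 0
      rw [ioc, Set.Ioc_self, Set.indicator_empty']
    simp [h]

/-- The defining property of the elementary integral. -/
lemma stepInt_stepInd {V : Type*} [AddCommGroup V] [Module ℝ V] (G : I → V) {a b : I}
    (h : a ≤ b) : stepInt G (stepInd a b) = G b - G a := by
  have h1 : stepInd a b = stepInd 0 b - stepInd 0 a := Subtype.ext (ioc_eq_sub h)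
  rw [h1, map_sub, stepInt_zero_left, stepInt_zero_left]
  abel

/-! ### Covariance kernels and the Hilbert space `H` -/

/-- A symmetric positive semidefinite kernel on `[0, 1]`. -/
structure CovKernel where
  toFun : I → I → ℝ
  posSemidef : (Matrix.of toFun).PosSemidef

/-- The bilinear form `∬ φ(s) ψ(t) dR(s, t)` on step functions, where `dR` gives the mass
`rect R a b c d` to the rectangle `(a, b] × (c, d]`. -/
def stepForm (R : CovKernel) (φ ψ : StepFun) : ℝ :=
  stepInt (fun s => stepInt (fun t => R.toFun s t) ψ) φ

lemma stepForm_stepInd (R : CovKernel) {a b c d : I} (h : a ≤ b) (h' : c ≤ d) :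
    stepForm R (stepInd a b) (stepInd c d) = rect R.toFun a b c d := by
  simp only [stepForm, stepInt_stepInd _ h, stepInt_stepInd _ h', rect]
  ring

/-- The values at the left end point `0` are subtracted: the increment of `R` over
`(0, s] × (0, t]`. -/
lemma stepForm_eq (R : CovKernel) (φ ψ : StepFun) :
    stepForm R φ ψ = (stepCoeff φ).sum fun s x => (stepCoeff ψ).sum fun t y =>
      x * y * rect R.toFun 0 s.1 0 t.1 := by
  simp only [stepForm, stepInt, LinearMap.comp_apply, Finsupp.linearCombination_apply,
    Finsupp.sum, smul_eq_mul, rect, ← Finset.sum_sub_distrib, Finset.mul_sum]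
  refine Finset.sum_congr rfl fun s _ => Finset.sum_congr rfl fun t _ => ?_
  ring

lemma CovKernel.symm (R : CovKernel) (s t : I) : R.toFun s t = R.toFun t s := by
  have h := R.posSemidef.1.apply s t
  simpa using h.symm

lemma stepForm_symm (R : CovKernel) (φ ψ : StepFun) : stepForm R φ ψ = stepForm R ψ φ := by
  rw [stepForm_eq, stepForm_eq, Finsupp.sum_comm]
  refine Finsupp.sum_congr fun t _ => Finsupp.sum_congr fun s _ => ?_
  simp only [rect]
  rw [R.symm s.1 t.1, R.symm s.1 0, R.symm 0 t.1]
  ring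

lemma stepForm_nonneg (R : CovKernel) (φ : StepFun) : 0 ≤ stepForm R φ φ := by
  classical
  set c := stepCoeff φ with hc
  let y : I →₀ ℝ := c.mapDomain Subtype.val - Finsupp.single 0 (c.sum fun _ x => x)
  have h := R.posSemidef.2 y
  have key : ∀ f : I → ℝ, (y.sum fun i x => x * f i) = c.sum fun s x => x * (f s.1 - f 0) := by
    intro f
    have h1 : (y.sum fun i x => x * f i) = Finsupp.linearCombination ℝ f y := by
      simp [Finsupp.linearCombination_apply]
    rw [h1, map_sub, Finsupp.linearCombination_mapDomain, Finsupp.linearCombination_single]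
    simp only [Finsupp.linearCombination_apply, Finsupp.sum, smul_eq_mul, Function.comp_apply,
      Finset.sum_mul, ← Finset.sum_sub_distrib]
    exact Finset.sum_congr rfl fun s _ => by ring
  have e : (y.sum fun i xi => y.sum fun j xj => star xi * Matrix.of R.toFun i j * xj) =
      stepForm R φ φ := by
    have e1 : (y.sum fun i xi => y.sum fun j xj => star xi * Matrix.of R.toFun i j * xj) =
        y.sum fun i xi => xi * (y.sum fun j xj => xj * R.toFun i j) := by
      refine Finsupp.sum_congr fun i _ => ?_
      rw [Finsupp.mul_sum]
      refine Finsupp.sum_congr fun j _ => ?_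
      simp
      ring
    rw [e1, key, stepForm_eq]
    refine Finsupp.sum_congr fun s _ => ?_
    rw [key, key, Finsupp.sum, Finsupp.sum, Finsupp.sum, ← Finset.sum_sub_distrib,
      Finset.mul_sum]
    refine Finset.sum_congr rfl fun t _ => ?_
    simp only [rect]
    ring
  rw [← e]
  exact h

/-- The space of step functions `f(t, i)` on `[0, 1] × {1, 2}` (the index set `{1, 2}` is `Fin 2`),
to be equipped with the inner product given by the kernels `R 0` and `R 1`. -/
def StepPair (_R : Fin 2 → CovKernel) : Type := Fin 2 → StepFun

variable {R : Fin 2 → CovKernel}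

instance : AddCommGroup (StepPair R) := inferInstanceAs (AddCommGroup (Fin 2 → StepFun))

instance : Module ℝ (StepPair R) := inferInstanceAs (Module ℝ (Fin 2 → StepFun))

/-- The inner product `∑ᵢ ∬ f(s, i) g(t, i) dRᵢ(s, t)`. -/
abbrev pairCore (R : Fin 2 → CovKernel) : PreInnerProductSpace.Core ℝ (StepPair R) where
  inner f g := ∑ i : Fin 2, stepForm (R i) (f i) (g i)
  conj_inner_symm f g := by
    simp only [stepForm_symm _ (g _) (f _), conj_trivial]
  re_inner_nonneg f := by
    rw [RCLike.re_to_real]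
    exact Finset.sum_nonneg fun i _ => stepForm_nonneg _ _
  add_left f g h := by
    rw [← Finset.sum_add_distrib]
    refine Finset.sum_congr rfl fun i _ => ?_
    exact map_add (stepInt _) (f i) (g i)
  smul_left f g r := by
    rw [conj_trivial, Finset.mul_sum]
    refine Finset.sum_congr rfl fun i _ => ?_
    exact map_smul (stepInt _) r (f i)

instance : SeminormedAddCommGroup (StepPair R) :=
  @InnerProductSpace.Core.toSeminormedAddCommGroup ℝ (StepPair R) _ _ _ (pairCore R)

instance : InnerProductSpace ℝ (StepPair R) := InnerProductSpace.ofCore (pairCore R)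

lemma inner_stepPair (f g : StepPair R) :
    inner ℝ f g = ∑ i : Fin 2, stepForm (R i) (f i) (g i) := rfl

/-- The Hilbert space `H`: the completion of the step functions on `[0, 1] × {1, 2}` (elements at
distance zero being identified). -/
abbrev HSpace (R : Fin 2 → CovKernel) : Type := UniformSpace.Completion (StepPair R)

/-- The Hilbert tensor square `H ⊗ H`. -/
abbrev HSq (R : Fin 2 → CovKernel) : Type :=
  UniformSpace.Completion (HSpace R ⊗[ℝ] HSpace R)

/-- The symmetric Hilbert tensor square: the closed linear span of the tensors `h ⊗ h`. -/
def HSym (R : Fin 2 → CovKernel) : Submodule ℝ (HSq R) :=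
  (Submodule.span ℝ (Set.range fun h : HSpace R =>
    ((h ⊗ₜ[ℝ] h : HSpace R ⊗[ℝ] HSpace R) : HSq R))).topologicalClosure

/-- The algebraic tensor square of the space of step functions on `[0, 1] × {1, 2}`. -/
abbrev StepSq (R : Fin 2 → CovKernel) : Type := StepPair R ⊗[ℝ] StepPair R

/-- The function `g_{ij}(s, t)` given by an element `g` of `StepSq R`; the tensor `f ⊗ f'` is the
function `f(s, i) f'(t, j)`. -/
def StepSq.eval : StepSq R →ₗ[ℝ] (Fin 2 → Fin 2 → I → I → ℝ) :=
  TensorProduct.lift (LinearMap.mk₂ ℝ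
    (fun (f f' : StepPair R) i j s t => (f i : I → ℝ) s * (f' j : I → ℝ) t)
    (fun _ _ _ => by funext i j s t; exact add_mul _ _ _)
    (fun _ _ _ => by funext i j s t; exact mul_assoc _ _ _)
    (fun _ _ _ => by funext i j s t; exact mul_add _ _ _)
    (fun _ _ _ => by funext i j s t; exact mul_left_comm _ _ _))

/-- The embedding of `StepSq R` into the Hilbert tensor square `H ⊗ H`. -/
def StepSq.toHSq : StepSq R →ₗ[ℝ] HSq R :=
  (UniformSpace.Completion.toComplL (𝕜 := ℝ) (E := HSpace R ⊗[ℝ] HSpace R)).toLinearMap ∘ₗ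
    TensorProduct.map
      (UniformSpace.Completion.toComplL (𝕜 := ℝ) (E := StepPair R)).toLinearMap
      (UniformSpace.Completion.toComplL (𝕜 := ℝ) (E := StepPair R)).toLinearMap

/-- The step functions are dense in the Hilbert tensor square. -/
lemma denseRange_toHSq (R : Fin 2 → CovKernel) :
    DenseRange (StepSq.toHSq : StepSq R → HSq R) := by
  let b : HSpace R →L[ℝ] HSpace R →L[ℝ] (HSpace R ⊗[ℝ] HSpace R) :=
    (TensorProduct.mk ℝ (HSpace R) (HSpace R)).mkContinuous₂ 1 (fun x y => by simp)
  have hd : DenseRange (TensorProduct.map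
      (UniformSpace.Completion.toComplL (𝕜 := ℝ) (E := StepPair R)).toLinearMap
      (UniformSpace.Completion.toComplL (𝕜 := ℝ) (E := StepPair R)).toLinearMap) := by
    intro x
    change x ∈ closure ((LinearMap.range (TensorProduct.map
      (UniformSpace.Completion.toComplL (𝕜 := ℝ) (E := StepPair R)).toLinearMap
      (UniformSpace.Completion.toComplL (𝕜 := ℝ) (E := StepPair R)).toLinearMap) :
        Submodule ℝ (HSpace R ⊗[ℝ] HSpace R)) : Set (HSpace R ⊗[ℝ] HSpace R))
    rw [← Submodule.topologicalClosure_coe, SetLike.mem_coe]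
    induction x using TensorProduct.induction_on with
    | zero => exact Submodule.zero_mem _
    | add x y hx hy => exact Submodule.add_mem _ hx hy
    | tmul h k =>
      change b h k ∈ _
      refine UniformSpace.Completion.induction_on₂ h k ?_ ?_
      · exact (Submodule.isClosed_topologicalClosure _).preimage
          (b.continuous₂)
      · intro f g
        exact Submodule.le_topologicalClosure _ ⟨f ⊗ₜ[ℝ] g, rfl⟩
  exact UniformSpace.Completion.denseRange_coe.comp hd
    (UniformSpace.Completion.continuous_coe _)

/-! ### The Lévy kernel and its dyadic approximations -/

/-- The antisymmetric matrix kernel built from the indicators of two regions: the entry `(1, 2)` is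
`(1_{T₁} - 1_{T₂}) / 2`, the entry `(2, 1)` is `(1_{T₂} - 1_{T₁}) / 2`, the others vanish. -/
def areaKernel (T₁ T₂ : Set (I × I)) (i j : Fin 2) (s t : I) : ℝ :=
  if i = j then 0
  else if i < j then (1 / 2) * (T₁.indicator 1 (s, t) - T₂.indicator 1 (s, t))
  else (1 / 2) * (T₂.indicator 1 (s, t) - T₁.indicator 1 (s, t))

/-- The Lévy kernel `f_{ij}(s, t)`. -/
def levyKernel : Fin 2 → Fin 2 → I → I → ℝ := areaKernel {x | x.1 < x.2} {x | x.2 < x.1}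

/-- The dyadic point `k / 2ⁿ`. -/
def dyadic (n : ℕ) (k : Fin (2 ^ n + 1)) : I :=
  ⟨(k : ℝ) / 2 ^ n, by positivity, by
    rw [div_le_one (by positivity)]
    exact_mod_cast Nat.lt_succ_iff.1 k.2⟩

/-- The dyadic interval `(k / 2ⁿ, (k + 1) / 2ⁿ]`. -/
def dyadicIoc (n : ℕ) (k : Fin (2 ^ n)) : Set I :=
  Set.Ioc (dyadic n k.castSucc) (dyadic n k.succ)

/-- The dyadic approximation of the Lévy kernel, as a function. -/
def levyApprox (n : ℕ) : Fin 2 → Fin 2 → I → I → ℝ :=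
  areaKernel
    (⋃ (k : Fin (2 ^ n)) (l : Fin (2 ^ n)) (_ : k < l), dyadicIoc n k ×ˢ dyadicIoc n l)
    (⋃ (k : Fin (2 ^ n)) (l : Fin (2 ^ n)) (_ : l < k), dyadicIoc n k ×ˢ dyadicIoc n l)

/-- The step function on `[0, 1] × {1, 2}` which is the indicator of a dyadic interval on the
`i`-th copy of `[0, 1]` and vanishes on the other one. -/
def dyadicInd (R : Fin 2 → CovKernel) (n : ℕ) (k : Fin (2 ^ n)) (i : Fin 2) : StepPair R :=
  Pi.single i (stepInd (dyadic n k.castSucc) (dyadic n k.succ))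

/-- The dyadic approximation of the Lévy kernel, as a tensor. -/
def levyStep (R : Fin 2 → CovKernel) (n : ℕ) : StepSq R :=
  ∑ k : Fin (2 ^ n), ∑ l : Fin (2 ^ n),
    if k < l then (1 / 2 : ℝ) • (dyadicInd R n k 0 ⊗ₜ[ℝ] dyadicInd R n l 1
      - dyadicInd R n k 1 ⊗ₜ[ℝ] dyadicInd R n l 0)
    else if l < k then (1 / 2 : ℝ) • (dyadicInd R n k 1 ⊗ₜ[ℝ] dyadicInd R n l 0
      - dyadicInd R n k 0 ⊗ₜ[ℝ] dyadicInd R n l 1)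
    else 0

lemma dyadic_strictMono (n : ℕ) : StrictMono (dyadic n) := by
  intro a b h
  rw [← Subtype.coe_lt_coe]
  simp only [dyadic]
  have : (a : ℝ) < b := by exact_mod_cast h
  gcongr

lemma dyadicIoc_disjoint {n : ℕ} {k l : Fin (2 ^ n)} {x : I} (hk : x ∈ dyadicIoc n k)
    (hl : x ∈ dyadicIoc n l) : k = l := by
  have aux : ∀ {a b : Fin (2 ^ n)}, x ∈ dyadicIoc n a → x ∈ dyadicIoc n b → ¬ a < b := by
    intro a b ha hb hab
    have h : dyadic n a.succ ≤ dyadic n b.castSucc :=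
      (dyadic_strictMono n).monotone (by
        rw [Fin.le_def]
        simpa using hab)
    exact absurd (ha.2.trans h) (not_le.2 hb.1)
  exact le_antisymm (not_lt.1 (aux hl hk)) (not_lt.1 (aux hk hl))

lemma dyadic_indicator_sum (n : ℕ) (r : Fin (2 ^ n) → Fin (2 ^ n) → Prop) [DecidableRel r]
    (s t : I) :
    ((⋃ (k : Fin (2 ^ n)) (l : Fin (2 ^ n)) (_ : r k l),
      dyadicIoc n k ×ˢ dyadicIoc n l).indicator 1 (s, t) : ℝ) =
    ∑ k : Fin (2 ^ n), ∑ l : Fin (2 ^ n), if r k l then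
      (dyadicIoc n k).indicator 1 s * (dyadicIoc n l).indicator 1 t else 0 := by
  classical
  by_cases h : ∃ k l, r k l ∧ s ∈ dyadicIoc n k ∧ t ∈ dyadicIoc n l
  · obtain ⟨k, l, hr, hk, hl⟩ := h
    rw [Set.indicator_of_mem (by simp only [Set.mem_iUnion]; exact ⟨k, l, hr, hk, hl⟩),
      Finset.sum_eq_single k, Finset.sum_eq_single l]
    · simp [hr, hk, hl]
    · intro l' _ hne
      have : t ∉ dyadicIoc n l' := fun h' => hne (dyadicIoc_disjoint h' hl)
      simp [this]
    · simp
    · intro k' _ hne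
      have : s ∉ dyadicIoc n k' := fun h' => hne (dyadicIoc_disjoint h' hk)
      simp [this]
    · simp
  · rw [Set.indicator_of_notMem]
    · symm
      refine Finset.sum_eq_zero fun k _ => Finset.sum_eq_zero fun l _ => ?_
      by_cases hr : r k l
      · by_cases hk : s ∈ dyadicIoc n k
        · have hl : t ∉ dyadicIoc n l := fun hl => h ⟨k, l, hr, hk, hl⟩
          simp [hl]
        · simp [hk]
      · simp [hr]
    · simp only [Set.mem_iUnion]
      rintro ⟨k, l, hr, hk, hl⟩
      exact h ⟨k, l, hr, hk, hl⟩

/-- The tensor `levyStep R n` represents the function `levyApprox n`. -/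
lemma eval_levyStep (R : Fin 2 → CovKernel) (n : ℕ) :
    StepSq.eval (levyStep R n) = levyApprox n := by
  have h1 : ∀ (k l : Fin (2 ^ n)) (a b i j : Fin 2) (s t : I),
      StepSq.eval (dyadicInd R n k a ⊗ₜ[ℝ] dyadicInd R n l b) i j s t =
        if i = a ∧ j = b then (dyadicIoc n k).indicator 1 s * (dyadicIoc n l).indicator 1 t
        else 0 := by
    intro k l a b i j s t
    have h2 : ∀ (k : Fin (2 ^ n)) (a i : Fin 2) (s : I),
        ((dyadicInd R n k a i : StepFun) : I → ℝ) s =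
          if i = a then (dyadicIoc n k).indicator 1 s else 0 := by
      intro k a i s
      by_cases h : i = a
      · subst h
        simp [dyadicInd, stepInd, ioc, dyadicIoc]
      · simp [dyadicInd, h]
    change ((dyadicInd R n k a i : StepFun) : I → ℝ) s *
      ((dyadicInd R n l b j : StepFun) : I → ℝ) t = _
    rw [h2, h2]
    by_cases hi : i = a <;> by_cases hj : j = b <;> simp [hi, hj]
  funext i j s t
  simp only [levyStep, levyApprox, areaKernel, dyadic_indicator_sum n (fun k l => k < l),
    dyadic_indicator_sum n (fun k l => l < k), map_sum, Finset.sum_apply,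
    ← Finset.sum_sub_distrib, Finset.mul_sum]
  have h3 : ∀ k l : Fin (2 ^ n), StepSq.eval (R := R) (
      if k < l then (1 / 2 : ℝ) • (dyadicInd R n k 0 ⊗ₜ[ℝ] dyadicInd R n l 1
        - dyadicInd R n k 1 ⊗ₜ[ℝ] dyadicInd R n l 0)
      else if l < k then (1 / 2 : ℝ) • (dyadicInd R n k 1 ⊗ₜ[ℝ] dyadicInd R n l 0
        - dyadicInd R n k 0 ⊗ₜ[ℝ] dyadicInd R n l 1)
      else 0) i j s t =
      if i = j then 0 else if i < j then
        (1 / 2) * ((if k < l then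
          (dyadicIoc n k).indicator 1 s * (dyadicIoc n l).indicator 1 t else 0) -
          (if l < k then
          (dyadicIoc n k).indicator 1 s * (dyadicIoc n l).indicator 1 t else 0))
      else (1 / 2) * ((if l < k then
          (dyadicIoc n k).indicator 1 s * (dyadicIoc n l).indicator 1 t else 0) -
          (if k < l then
          (dyadicIoc n k).indicator 1 s * (dyadicIoc n l).indicator 1 t else 0)) := by
    intro k l
    rcases lt_trichotomy k l with h | h | h
    · simp only [h, if_true, not_lt.2 h.le, if_false, map_smul, map_sub, Pi.smul_apply,
        Pi.sub_apply, h1]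
      fin_cases i <;> fin_cases j <;> simp
    · subst h
      simp
    · simp only [h, if_true, not_lt.2 h.le, if_false, map_smul, map_sub, Pi.smul_apply,
        Pi.sub_apply, h1]
      fin_cases i <;> fin_cases j <;> simp
  simp only [h3]
  split_ifs <;> simp

/-! ### Gaussian processes and the double Wiener–Itô integral -/

section Probability

variable {Ω : Type*} [MeasurableSpace Ω]

/-- The covariance function of a Gaussian process on `[0, 1]`. -/
def covKernel (P : Measure Ω) (Y : I → Ω → ℝ) (hY : IsGaussianProcess Y P) : CovKernel where
  toFun s t := cov[Y s, Y t; P]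
  posSemidef := by
    classical
    have hP : IsProbabilityMeasure P := hY.isProbabilityMeasure
    have hL : ∀ t, MemLp (Y t) 2 P := fun t => (hY.hasGaussianLaw_eval t).memLp_two
    refine ⟨?_, fun x => ?_⟩
    · ext s t
      simp [covariance_comm (Y s) (Y t)]
    · have h : (x.sum fun i xi => x.sum fun j xj =>
          star xi * Matrix.of (fun s t => cov[Y s, Y t; P]) i j * xj) =
          Var[fun ω => ∑ i ∈ x.support, x i * Y i ω; P] := by
        rw [variance_fun_sum' (fun i _ => (hL i).const_mul (x i))]
        simp only [Finsupp.sum]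
        refine Finset.sum_congr rfl fun i _ => Finset.sum_congr rfl fun j _ => ?_
        rw [covariance_const_mul_left, covariance_const_mul_right]
        simp
        ring
      rw [h]
      exact variance_nonneg _ _

/-- The elementary Wiener integral `X(f) = ∫ f(t, 1) dX₁(t) + ∫ f(t, 2) dX₂(t)` of a step function
on `[0, 1] × {1, 2}`. -/
def wienerStep (R : Fin 2 → CovKernel) (X : Fin 2 → I → Ω → ℝ) : StepPair R →ₗ[ℝ] (Ω → ℝ) :=
  ∑ i : Fin 2, stepInt (X i) ∘ₗ LinearMap.proj (φ := fun _ : Fin 2 => StepFun) i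

/-- The elementary double Wiener–Itô integral: the linear map with
`I₂(f ⊗ g) = X(f) X(g) - ⟨f, g⟩`. -/
def doubleWienerStep (R : Fin 2 → CovKernel) (X : Fin 2 → I → Ω → ℝ) :
    StepSq R →ₗ[ℝ] (Ω → ℝ) :=
  TensorProduct.lift (LinearMap.mk₂ ℝ
    (fun (f g : StepPair R) ω => wienerStep R X f ω * wienerStep R X g ω - inner ℝ f g)
    (fun _ _ _ => by
      funext ω
      simp only [map_add, Pi.add_apply, inner_add_left]
      ring)
    (fun _ _ _ => by
      funext ω
      simp only [map_smul, Pi.smul_apply, inner_smul_left, smul_eq_mul, conj_trivial]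
      ring)
    (fun _ _ _ => by
      funext ω
      simp only [map_add, Pi.add_apply, inner_add_right]
      ring)
    (fun _ _ _ => by
      funext ω
      simp only [map_smul, Pi.smul_apply, inner_smul_right, smul_eq_mul]
      ring))

/-- The square integrable random variable `A` is the double Wiener–Itô integral `I₂(F)`: the map
`I₂` on step functions, extended by continuity from `StepSq R` (with the norm of `H ⊗ H`) to
`L²(P)`, takes the value `A` at `F`. (On non-symmetric `F` this is `I₂` of the symmetrization.) -/
def IsDoubleWienerIntegral (P : Measure Ω) (R : Fin 2 → CovKernel) (X : Fin 2 → I → Ω → ℝ)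
    (F : HSq R) (A : Ω → ℝ) : Prop :=
  MemLp A 2 P ∧
    Tendsto (fun u : StepSq R => eLpNorm (doubleWienerStep R X u - A) 2 P)
      (comap StepSq.toHSq (𝓝 F)) (𝓝 0)

end Probability

end LevyArea

end

open LevyArea

/-!
The proof rests on one estimate. For kernels `r₀`, `r₁` of finite two-dimensional `p`- and
`q`-variation with `1 / p + 1 / q > 1`, the Riemann sums of `r₀` against `dr₁` over tagged grids are
bounded by a constant times the product of the variations, uniformly over all grids (`young_towghi`,
`abs_tagSum_le`). This is Young's point removal argument: the points of the grid are removed in the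
first direction one after the other, each time at a place where the change is small, and the change
is a one-dimensional Young sum in the second direction.

Since the paths are almost surely continuous, the characteristic functions of the increments
converge, so the processes are continuous in mean square and the covariances are continuous
(`continuous_covKernel`). Rounding the arguments of a continuous kernel down to the dyadic points of
level `N` therefore changes it little in supremum norm, hence, by interpolation, in `p'`-variation
for every `p' > p`. As there is room in `1 / p + 1 / q > 1`, rounding changes the Riemann sums by
little, again uniformly over all grids (`exists_abs_tagSum_sub_le`).

*Convergence.* Summation by parts writes the inner products `⟨fₙ, fₘ⟩` as combinations of tagged
sums of the covariances (`levyGram_eq_tagSum`). For kernels rounded to level `N` they do not depend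
on `n, m ≥ N` at all: a rounded function jumps at most once in every interval of level `N`, so two
jumps in the same interval of level `N` occupy the same interval of the finer level, and `fₙ`
vanishes on its square, as `f_N` does on the square of the coarser one (`levyGram_roundKernel`).
Hence `⟨fₙ, fₘ⟩` converges as `n, m → ∞`, and `(fₙ)` is a Cauchy sequence
(`cauchySeq_toHSq_levyStep`). Each `fₙ` is a combination of tensors `x ⊗ y + y ⊗ x`, so the limit is
symmetric.

*Iterated integrals.* By linearity it suffices to take `g` the tensor product of two indicators of
intervals `(0, b]` and `(0, d]`. The inner sums telescope, and the outer integral is a Young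
integral whose Riemann sums, after rounding, are those of a step function. Their limit is also the
limit of `⟨fₙ, g⟩` (`hasIteratedRSIntegral_levyKernel_mul_ioc`, `levyPairing_eq_top`).

*The double Wiener–Itô integral.* The Wiener integral is an isonormal family
(`isIsonormal_wienerStep`). Wick's formula (`IsIsonormal.integral_mul_mul_mul`) gives `E[I₂(u)
I₂(v)] = ⟨u, v⟩ + ⟨u, vᵀ⟩` for step functions, `vᵀ` being `v` with its arguments exchanged. So `I₂`
is Lipschitz for the norm of `H ⊗ H` and extends to all of it by density
(`exists_isDoubleWienerIntegral`).
-/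

namespace LevyArea

/-! ### Discrete sewing -/

/-- The enumeration of `ℕ` which leaves out `k + 1`. -/
def skipSucc (k j : ℕ) : ℕ := if j ≤ k then j else j + 1

lemma monotone_skipSucc (k : ℕ) : Monotone (skipSucc k) := by
  intro a b h
  simp only [skipSucc]
  split_ifs <;> omega

lemma sum_range_skipSucc {E T : Type*} [AddCommGroup E] (A : T → T → E) (τ : ℕ → T) {k n : ℕ}
    (hk : k ≤ n) :
    ∑ i ∈ Finset.range (n + 2), A (τ i) (τ (i + 1)) =
      (∑ i ∈ Finset.range (n + 1), A (τ (skipSucc k i)) (τ (skipSucc k (i + 1)))) +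
        (A (τ k) (τ (k + 1)) + A (τ (k + 1)) (τ (k + 2)) - A (τ k) (τ (k + 2))) := by
  obtain ⟨m, rfl⟩ := Nat.exists_eq_add_of_le hk
  rw [show k + m + 2 = k + (m + 2) by ring, show k + m + 1 = k + (m + 1) by ring,
    Finset.sum_range_add _ k, Finset.sum_range_add _ k, Finset.sum_range_succ' _ (m + 1),
    Finset.sum_range_succ' _ m, Finset.sum_range_succ' _ m]
  have h1 : ∀ i ∈ Finset.range k, A (τ (skipSucc k i)) (τ (skipSucc k (i + 1))) =
      A (τ i) (τ (i + 1)) := by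
    intro i hi
    have : i < k := Finset.mem_range.1 hi
    rw [skipSucc, skipSucc, if_pos (by omega), if_pos (by omega)]
  have h2 : ∀ i ∈ Finset.range m, A (τ (skipSucc k (k + (i + 1))))
      (τ (skipSucc k (k + (i + 1) + 1))) = A (τ (k + (i + 1 + 1))) (τ (k + (i + 1 + 1) + 1)) := by
    intro i _
    rw [skipSucc, skipSucc, if_neg (by omega), if_neg (by omega)]
    rfl
  have h3 : A (τ (skipSucc k (k + 0))) (τ (skipSucc k (k + 0 + 1))) = A (τ k) (τ (k + 2)) := by
    rw [skipSucc, skipSucc, if_pos (by omega), if_neg (by omega)]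
    rfl
  rw [Finset.sum_congr rfl h1, Finset.sum_congr rfl h2, h3]
  simp only [add_zero, zero_add, add_assoc, Nat.reduceAdd]
  abel

/-- If every chain of `n + 3` points contains three consecutive points at which `A` fails to be
additive by at most `c n`, then removing these middle points one after the other bounds the
distance between the sum of `A` along a chain and its value at the end points. -/
lemma sewing_bound {E T : Type*} [AddCommGroup E] [Preorder T] (N : E → ℝ) (h0 : N 0 ≤ 0)
    (hadd : ∀ x y, N (x + y) ≤ N x + N y) (A : T → T → E) (c : ℕ → ℝ)
    (h : ∀ n, ∀ τ : ℕ → T, Monotone τ → ∃ k ≤ n,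
      N (A (τ k) (τ (k + 1)) + A (τ (k + 1)) (τ (k + 2)) - A (τ k) (τ (k + 2))) ≤ c n)
    (n : ℕ) (τ : ℕ → T) (hτ : Monotone τ) :
    N (∑ i ∈ Finset.range (n + 1), A (τ i) (τ (i + 1)) - A (τ 0) (τ (n + 1))) ≤
      ∑ m ∈ Finset.range n, c m := by
  induction n generalizing τ with
  | zero => simpa using h0
  | succ n ih =>
    obtain ⟨k, hk, hkc⟩ := h n τ hτ
    have h1 := ih (fun j => τ (skipSucc k j)) (hτ.comp (monotone_skipSucc k))
    have e0 : skipSucc k 0 = 0 := by simp [skipSucc]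
    have e1 : skipSucc k (n + 1) = n + 1 + 1 := by
      rw [skipSucc, if_neg (by omega)]
    simp only [e0, e1] at h1
    rw [sum_range_skipSucc A τ hk, add_sub_right_comm, Finset.sum_range_succ c]
    exact (hadd _ _).trans (add_le_add h1 hkc)

/-! ### Young's inequality for vector-valued sequences -/

/-- Hölder's inequality for exponents whose sum may exceed one. -/
lemma sum_rpow_mul_rpow_le {ι : Type*} (s : Finset ι) (u v : ι → ℝ) (hu : ∀ i ∈ s, 0 ≤ u i)
    (hv : ∀ i ∈ s, 0 ≤ v i) {a b : ℝ} (ha : 0 < a) (hb : 0 < b) (hab : 1 ≤ a + b) :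
    ∑ i ∈ s, u i ^ a * v i ^ b ≤ (∑ i ∈ s, u i) ^ a * (∑ i ∈ s, v i) ^ b := by
  have hU0 := Finset.sum_nonneg hu
  have hV0 := Finset.sum_nonneg hv
  set U := ∑ i ∈ s, u i with hU
  set V := ∑ i ∈ s, v i with hV
  rcases hU0.eq_or_lt with h | hUp
  · have : ∀ i ∈ s, u i = 0 := (Finset.sum_eq_zero_iff_of_nonneg hu).1 h.symm
    rw [Finset.sum_eq_zero fun i hi => by rw [this i hi, Real.zero_rpow ha.ne', zero_mul]]
    positivity
  rcases hV0.eq_or_lt with h | hVp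
  · have : ∀ i ∈ s, v i = 0 := (Finset.sum_eq_zero_iff_of_nonneg hv).1 h.symm
    rw [Finset.sum_eq_zero fun i hi => by rw [this i hi, Real.zero_rpow hb.ne', mul_zero]]
    positivity
  -- reduce to exponents with sum one, the ratios `u i / U` and `v i / V` being at most one
  have key : ∀ i ∈ s, u i ^ a * v i ^ b ≤
      U ^ a * V ^ b * (a / (a + b) * (u i / U) + b / (a + b) * (v i / V)) := by
    intro i hi
    have hx0 : 0 ≤ u i / U := div_nonneg (hu i hi) hU0
    have hy0 : 0 ≤ v i / V := div_nonneg (hv i hi) hV0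
    have hx1 : u i / U ≤ 1 := (div_le_one hUp).2 (Finset.single_le_sum hu hi)
    have hy1 : v i / V ≤ 1 := (div_le_one hVp).2 (Finset.single_le_sum hv hi)
    have e : u i ^ a * v i ^ b = U ^ a * V ^ b * ((u i / U) ^ a * (v i / V) ^ b) := by
      rw [Real.div_rpow (hu i hi) hU0, Real.div_rpow (hv i hi) hV0]
      field_simp
    have hd : ∀ {x c : ℝ}, 0 ≤ x → x ≤ 1 → 0 < c → x ^ c ≤ x ^ (c / (a + b)) := by
      intro x c h0 h1 hc
      refine Real.rpow_le_rpow_of_exponent_ge' h0 h1 (by positivity) (div_le_self hc.le hab)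
    have := Real.geom_mean_le_arith_mean2_weighted (w₁ := a / (a + b)) (w₂ := b / (a + b))
      (by positivity) (by positivity) hx0 hy0 (by field_simp)
    rw [e]
    refine mul_le_mul_of_nonneg_left (le_trans ?_ this) (by positivity)
    exact mul_le_mul (hd hx0 hx1 ha) (hd hy0 hy1 hb) (by positivity) (by positivity)
  refine (Finset.sum_le_sum key).trans (le_of_eq ?_)
  rw [← Finset.mul_sum, Finset.sum_add_distrib, ← Finset.mul_sum, ← Finset.mul_sum,
    ← Finset.sum_div, ← Finset.sum_div, ← hU, ← hV, div_self hUp.ne', div_self hVp.ne']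
  field_simp

/-- Two sequences with bounded sums are simultaneously small at some index. -/
lemma exists_le_two_mul_div {n : ℕ} {a b : ℕ → ℝ} (ha : ∀ k, 0 ≤ a k) (hb : ∀ k, 0 ≤ b k)
    {K L : ℝ} (hK : 0 < K) (hL : 0 < L) (hKa : ∑ k ∈ Finset.range (n + 1), a k ≤ K)
    (hLb : ∑ k ∈ Finset.range (n + 1), b k ≤ L) :
    ∃ k ≤ n, a k ≤ 2 * K / (n + 1) ∧ b k ≤ 2 * L / (n + 1) := by
  by_contra! hcon
  have h : ∀ k ∈ Finset.range (n + 1), 2 / ((n : ℝ) + 1) < a k / K + b k / L := by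
    intro k hk
    have hk' : k ≤ n := Nat.lt_succ_iff.1 (Finset.mem_range.1 hk)
    have h1 : 0 ≤ a k / K := div_nonneg (ha k) hK.le
    have h2 : 0 ≤ b k / L := div_nonneg (hb k) hL.le
    rcases le_or_gt (a k) (2 * K / (n + 1)) with h3 | h3
    · have h4 : 2 / ((n : ℝ) + 1) < b k / L := by
        rw [lt_div_iff₀ hL]
        convert hcon k hk' h3 using 1
        ring
      linarith
    · have h4 : 2 / ((n : ℝ) + 1) < a k / K := by
        rw [lt_div_iff₀ hK]
        convert h3 using 1
        ring
      linarith
  have h5 := Finset.sum_lt_sum_of_nonempty ⟨0, by simp⟩ h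
  rw [Finset.sum_add_distrib, Finset.sum_const, Finset.card_range, nsmul_eq_mul,
    ← Finset.sum_div, ← Finset.sum_div] at h5
  have h6 : (∑ k ∈ Finset.range (n + 1), a k) / K ≤ 1 := (div_le_one hK).2 hKa
  have h7 : (∑ k ∈ Finset.range (n + 1), b k) / L ≤ 1 := (div_le_one hL).2 hLb
  have h8 : ((n + 1 : ℕ) : ℝ) * (2 / ((n : ℝ) + 1)) = 2 := by
    push_cast
    field_simp
  linarith

lemma sum_abs_rpow_add_le {ι : Type*} (s : Finset ι) {ρ : ℝ} (h0 : 0 < ρ) (h1 : ρ ≤ 1)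
    (x y : ι → ℝ) :
    ∑ i ∈ s, |(x + y) i| ^ ρ ≤ (∑ i ∈ s, |x i| ^ ρ) + ∑ i ∈ s, |y i| ^ ρ := by
  rw [← Finset.sum_add_distrib]
  refine Finset.sum_le_sum fun i _ => ?_
  calc |(x + y) i| ^ ρ ≤ (|x i| + |y i|) ^ ρ :=
        Real.rpow_le_rpow (abs_nonneg _) (abs_add_le _ _) h0.le
    _ ≤ _ := Real.rpow_add_le_add_rpow (abs_nonneg _) (abs_nonneg _) h0.le h1

/-- Young's inequality for the coordinatewise product of sequences of vectors: the sequences have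
finite variation as sequences in `ℓ^p` and `ℓ^q`, the sum is measured in `ℓ^ρ` with `ρ ≤ 1`, where
`ρ / p + ρ / q > 1` is needed for the series to converge. -/
lemma young_vector {ι : Type*} (s : Finset ι) {p q ρ : ℝ} (hp : 0 < p) (hq : 0 < q) (hρ : 0 < ρ)
    (hρ1 : ρ ≤ 1) (hθ : 1 < ρ / p + ρ / q) {K L : ℝ} (hK : 0 < K) (hL : 0 < L)
    (x y : ℕ → ι → ℝ) (hx0 : x 0 = 0)
    (hx : ∀ n, ∀ τ : ℕ → ℕ, Monotone τ →
      ∑ k ∈ Finset.range n, ∑ i ∈ s, |x (τ (k + 1)) i - x (τ k) i| ^ p ≤ K)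
    (hy : ∀ n, ∀ τ : ℕ → ℕ, Monotone τ →
      ∑ k ∈ Finset.range n, ∑ i ∈ s, |y (τ (k + 1)) i - y (τ k) i| ^ q ≤ L) (n : ℕ) :
    ∑ i ∈ s, |∑ k ∈ Finset.range n, x k i * (y (k + 1) i - y k i)| ^ ρ ≤
      (2 * K) ^ (ρ / p) * (2 * L) ^ (ρ / q) *
        ∑' m : ℕ, 1 / ((m : ℝ) + 1) ^ (ρ / p + ρ / q) := by
  have hsum : Summable fun m : ℕ => 1 / ((m : ℝ) + 1) ^ (ρ / p + ρ / q) := by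
    have := (summable_nat_add_iff 1).2 (Real.summable_one_div_nat_rpow.2 hθ)
    simpa using this
  have hnn : ∀ m : ℕ, 0 ≤ 1 / ((m : ℝ) + 1) ^ (ρ / p + ρ / q) := fun m => by positivity
  rcases n with _ | n
  · simp only [Finset.range_zero, Finset.sum_empty, abs_zero, Real.zero_rpow hρ.ne',
      Finset.sum_const_zero]
    exact mul_nonneg (by positivity) (tsum_nonneg hnn)
  have key := sewing_bound (fun z : ι → ℝ => ∑ i ∈ s, |z i| ^ ρ)
    (by simp [Real.zero_rpow hρ.ne']) (sum_abs_rpow_add_le s hρ hρ1)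
    (fun j k : ℕ => x j * (y k - y j))
    (fun m => (2 * K) ^ (ρ / p) * (2 * L) ^ (ρ / q) *
      (1 / ((m : ℝ) + 1) ^ (ρ / p + ρ / q))) ?_ n id monotone_id
  · simp only [id, hx0, zero_mul, Finset.sum_apply, Pi.mul_apply, Pi.sub_apply, Pi.zero_apply,
      sub_zero] at key
    refine key.trans ?_
    rw [← Finset.mul_sum]
    gcongr
    exact hsum.sum_le_tsum _ fun m _ => hnn m
  · intro m τ hτ
    obtain ⟨k, hk, hka, hkb⟩ := exists_le_two_mul_div (n := m)
      (a := fun k => ∑ i ∈ s, |x (τ (k + 1)) i - x (τ k) i| ^ p)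
      (b := fun k => ∑ i ∈ s, |y (τ (k + 2)) i - y (τ (k + 1)) i| ^ q)
      (fun k => by positivity) (fun k => by positivity) hK hL (hx _ τ hτ)
      (hy _ (fun k => τ (k + 1)) fun a b h => hτ (by omega))
    refine ⟨k, hk, ?_⟩
    have e : ∀ i, |(x (τ k) * (y (τ (k + 1)) - y (τ k)) + x (τ (k + 1)) *
        (y (τ (k + 2)) - y (τ (k + 1))) - x (τ k) * (y (τ (k + 2)) - y (τ k))) i| ^ ρ =
        (|x (τ (k + 1)) i - x (τ k) i| ^ p) ^ (ρ / p) *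
          (|y (τ (k + 2)) i - y (τ (k + 1)) i| ^ q) ^ (ρ / q) := by
      intro i
      rw [← Real.rpow_mul (abs_nonneg _), ← Real.rpow_mul (abs_nonneg _),
        mul_div_cancel₀ _ hp.ne', mul_div_cancel₀ _ hq.ne',
        ← Real.mul_rpow (abs_nonneg _) (abs_nonneg _), ← abs_mul]
      congr 2
      simp only [Pi.sub_apply, Pi.add_apply, Pi.mul_apply]
      ring
    simp only [e]
    refine (sum_rpow_mul_rpow_le s _ _ (fun i _ => by positivity) (fun i _ => by positivity)
      (by positivity) (by positivity) hθ.le).trans ?_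
    have hm : (0 : ℝ) < m + 1 := by positivity
    calc _ ≤ (2 * K / (m + 1)) ^ (ρ / p) * (2 * L / (m + 1)) ^ (ρ / q) := by gcongr
      _ = _ := by
        rw [Real.div_rpow (by positivity) hm.le, Real.div_rpow (by positivity) hm.le,
          Real.rpow_add hm]
        field_simp

/-! ### The Young–Towghi inequality -/

/-- The sums of the `p`-th powers of the rectangular increments of `f` over grids are at most `K`.
Grids are given by monotone sequences, so they may have degenerate cells and need not reach the
end points; this makes the notion stable under monotone reparametrizations. -/
def VarLE {α : Type*} [Preorder α] (f : α → α → ℝ) (p K : ℝ) : Prop :=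
  ∀ (n m : ℕ) (x y : ℕ → α), Monotone x → Monotone y →
    ∑ i ∈ Finset.range n, ∑ j ∈ Finset.range m,
      |f (x (i + 1)) (y (j + 1)) - f (x (i + 1)) (y j) - f (x i) (y (j + 1)) + f (x i) (y j)| ^ p
        ≤ K

lemma VarLE.comp {α β : Type*} [Preorder α] [Preorder β] {f : α → α → ℝ} {p K : ℝ}
    (h : VarLE f p K) {u v : β → α} (hu : Monotone u) (hv : Monotone v) :
    VarLE (fun s t => f (u s) (v t)) p K :=
  fun n m x y hx hy => h n m (u ∘ x) (v ∘ y) (hu.comp hx) (hv.comp hy)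

lemma exists_rpow_le_of_sum_le {n : ℕ} {z : ℕ → ℝ} {ρ M : ℝ} (hρ : 0 < ρ)
    (h : ∑ k ∈ Finset.range (n + 1), |z k| ^ ρ ≤ M) :
    ∃ k ≤ n, |z k| ≤ M ^ ρ⁻¹ * (1 / ((n : ℝ) + 1) ^ ρ⁻¹) := by
  have hM : 0 ≤ M := le_trans (by positivity) h
  obtain ⟨k, hk, hkM⟩ := Finset.exists_le_of_sum_le (s := Finset.range (n + 1))
    (f := fun k => |z k| ^ ρ) (g := fun _ => M / (n + 1)) ⟨0, by simp⟩ (by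
      rw [Finset.sum_const, Finset.card_range, nsmul_eq_mul]
      push_cast
      rwa [mul_div_cancel₀ _ (by positivity)])
  refine ⟨k, Nat.lt_succ_iff.1 (Finset.mem_range.1 hk), ?_⟩
  rw [mul_one_div, ← Real.div_rpow hM (by positivity), ← Real.rpow_rpow_inv (abs_nonneg (z k))
    hρ.ne']
  exact Real.rpow_le_rpow (by positivity) hkM (by positivity)

/-- The Young–Towghi inequality for double sequences vanishing on the axes. Points are removed in
the first direction; the change caused by the removal of a point is itself a Young sum in the second
direction, and all these changes are estimated simultaneously by `young_vector`. -/
lemma young_towghi {p q : ℝ} (hp : 0 < p) (hq : 0 < q) (hpq : 1 < p⁻¹ + q⁻¹) :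
    ∃ C : ℝ, 0 ≤ C ∧ ∀ (K L : ℝ) (F G : ℕ → ℕ → ℝ), 0 < K → 0 < L → VarLE F p K → VarLE G q L →
      (∀ j, F 0 j = 0) → (∀ i, F i 0 = 0) → ∀ n m : ℕ,
        |∑ i ∈ Finset.range n, ∑ j ∈ Finset.range m,
          F i j * (G (i + 1) (j + 1) - G (i + 1) j - G i (j + 1) + G i j)| ≤
            C * (K ^ p⁻¹ * L ^ q⁻¹) := by
  -- an exponent with `1 < ρ⁻¹ < p⁻¹ + q⁻¹`
  obtain ⟨ρ, hρ, hρi⟩ : ∃ ρ : ℝ, 0 < ρ ∧ ρ⁻¹ = (1 + (p⁻¹ + q⁻¹)) / 2 :=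
    ⟨((1 + (p⁻¹ + q⁻¹)) / 2)⁻¹, by positivity, by rw [inv_inv]⟩
  have hρ1 : 1 < ρ⁻¹ := by rw [hρi]; linarith
  have hρ1' : ρ ≤ 1 := by
    rw [← inv_inv ρ]
    exact inv_le_one_of_one_le₀ hρ1.le
  have hθ : 1 < ρ / p + ρ / q := by
    have h1 : ρ⁻¹ < p⁻¹ + q⁻¹ := by rw [hρi]; linarith
    have h2 : ρ / p + ρ / q = ρ * (p⁻¹ + q⁻¹) := by ring
    rw [h2]
    calc (1 : ℝ) = ρ * ρ⁻¹ := (mul_inv_cancel₀ hρ.ne').symm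
      _ < _ := by gcongr
  set Z : ℝ := ∑' m : ℕ, 1 / ((m : ℝ) + 1) ^ (ρ / p + ρ / q) with hZ
  have hZ0 : 0 ≤ Z := tsum_nonneg fun m => by positivity
  have hsum : Summable fun m : ℕ => 1 / ((m : ℝ) + 1) ^ ρ⁻¹ := by
    have := (summable_nat_add_iff 1).2 (Real.summable_one_div_nat_rpow.2 hρ1)
    simpa using this
  set Z' : ℝ := ∑' m : ℕ, 1 / ((m : ℝ) + 1) ^ ρ⁻¹ with hZ'
  have hZ'0 : 0 ≤ Z' := tsum_nonneg fun m => by positivity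
  refine ⟨2 ^ p⁻¹ * 2 ^ q⁻¹ * Z ^ ρ⁻¹ * Z', by positivity, ?_⟩
  intro K L F G hK hL hF hG hF0 hF0' n m
  set M : ℝ := (2 * K) ^ (ρ / p) * (2 * L) ^ (ρ / q) * Z with hM
  have hMρ : M ^ ρ⁻¹ = 2 ^ p⁻¹ * 2 ^ q⁻¹ * Z ^ ρ⁻¹ * (K ^ p⁻¹ * L ^ q⁻¹) := by
    rw [hM, Real.mul_rpow (by positivity) hZ0, Real.mul_rpow (by positivity) (by positivity),
      ← Real.rpow_mul (by positivity), ← Real.rpow_mul (by positivity),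
      Real.mul_rpow (by norm_num) hK.le, Real.mul_rpow (by norm_num) hL.le,
      show ρ / p * ρ⁻¹ = p⁻¹ by field_simp, show ρ / q * ρ⁻¹ = q⁻¹ by field_simp]
    ring
  rcases n with _ | n
  · simp only [Finset.range_zero, Finset.sum_empty, abs_zero]
    positivity
  have key := sewing_bound (fun z : ℝ => |z|) (by simp) abs_add_le
    (fun i k : ℕ => ∑ j ∈ Finset.range m,
      F i j * (G k (j + 1) - G k j - G i (j + 1) + G i j))
    (fun n => M ^ ρ⁻¹ * (1 / ((n : ℝ) + 1) ^ ρ⁻¹)) ?_ n id monotone_id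
  · simp only [id, hF0, zero_mul, Finset.sum_const_zero, sub_zero] at key
    refine key.trans ?_
    rw [← Finset.mul_sum]
    calc _ ≤ M ^ ρ⁻¹ * Z' := by
          have : 0 ≤ M := by positivity
          gcongr
          exact hsum.sum_le_tsum _ fun m _ => by positivity
      _ = _ := by rw [hMρ]; ring
  · intro l x hx
    have h1 := young_vector (Finset.range (l + 1)) hp hq hρ hρ1' hθ hK hL
      (fun j k => F (x (k + 1)) j - F (x k) j) (fun j k => G (x (k + 2)) j - G (x (k + 1)) j)
      (by funext k; simp [hF0']) ?_ ?_ m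
    · obtain ⟨k, hk, hkM⟩ := exists_rpow_le_of_sum_le hρ h1
      refine ⟨k, hk, ?_⟩
      refine le_trans (le_of_eq ?_) hkM
      rw [← Finset.sum_add_distrib, ← Finset.sum_sub_distrib]
      congr 1
      refine Finset.sum_congr rfl fun j _ => ?_
      ring
    · intro n y hy
      rw [Finset.sum_comm]
      refine le_trans (le_of_eq ?_) (hF (l + 1) n x y hx hy)
      refine Finset.sum_congr rfl fun i _ => Finset.sum_congr rfl fun j _ => ?_
      congr 2
      ring
    · intro n y hy
      rw [Finset.sum_comm]
      refine le_trans (le_of_eq ?_) (hG (l + 1) n (fun k => x (k + 1)) y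
        (fun a b h => hx (by omega)) hy)
      refine Finset.sum_congr rfl fun i _ => Finset.sum_congr rfl fun j _ => ?_
      congr 2
      ring

/-- The sequence `0, x 0, x 1, …`. -/
def prependZero (x : ℕ → I) (i : ℕ) : I := if i = 0 then 0 else x (i - 1)

lemma monotone_prependZero {x : ℕ → I} (hx : Monotone x) : Monotone (prependZero x) := by
  intro a b h
  simp only [prependZero]
  split_ifs with h1 h2
  · exact le_rfl
  · exact unitInterval.nonneg'
  · omega
  · exact hx (by omega)

/-- The sequence `x 0, x 0, x 1, …`. -/
def repeatHead (x : ℕ → I) (i : ℕ) : I := x (i - 1)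

lemma monotone_repeatHead {x : ℕ → I} (hx : Monotone x) : Monotone (repeatHead x) :=
  fun _ _ h => hx (by omega)

/-- The tagged sum `∑ r₀(a i, b j) Δr₁(i, j)` over the first `n × m` cells of the grid `s × t`,
where `r₀` is replaced by its increment from the axes. -/
def tagSum (r₀ r₁ : I → I → ℝ) (n m : ℕ) (a b s t : ℕ → I) : ℝ :=
  ∑ i ∈ Finset.range n, ∑ j ∈ Finset.range m,
    rect r₀ 0 (a i) 0 (b j) * rect r₁ (s i) (s (i + 1)) (t j) (t (j + 1))

/-- The Young–Towghi inequality for tagged sums. The tags `a`, `b` need not lie in the cells of the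
grid `s × t`: it is enough that all four sequences are monotone. -/
lemma abs_tagSum_le {p q : ℝ} (hp : 0 < p) (hq : 0 < q) (hpq : 1 < p⁻¹ + q⁻¹) :
    ∃ C : ℝ, 0 ≤ C ∧ ∀ (K L : ℝ) (r₀ r₁ : I → I → ℝ), 0 < K → 0 < L → VarLE r₀ p K → VarLE r₁ q L →
      ∀ (n m : ℕ) (a b s t : ℕ → I), Monotone a → Monotone b → Monotone s → Monotone t →
        |tagSum r₀ r₁ n m a b s t| ≤ C * (K ^ p⁻¹ * L ^ q⁻¹) := by
  obtain ⟨C, hC, h⟩ := young_towghi hp hq hpq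
  refine ⟨C, hC, fun K L r₀ r₁ hK hL h₀ h₁ n m a b s t ha hb hs ht => ?_⟩
  have h2 := h K L (fun i j => rect r₀ 0 (prependZero a i) 0 (prependZero b j))
    (fun i j => r₁ (repeatHead s i) (repeatHead t j)) hK hL ?_
    (h₁.comp (monotone_repeatHead hs) (monotone_repeatHead ht))
    (by intro j; simp [rect, prependZero]) (by intro i; simp [rect, prependZero]) (n + 1) (m + 1)
  · refine le_trans (le_of_eq ?_) h2
    rw [Finset.sum_range_succ', tagSum]
    congr 1
    rw [Finset.sum_eq_zero (s := Finset.range (m + 1)) fun j _ => by simp [rect, prependZero],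
      add_zero]
    refine Finset.sum_congr rfl fun i _ => ?_
    rw [Finset.sum_range_succ']
    simp [prependZero, repeatHead, rect]
  · intro n' m' x y hx hy
    refine le_trans (le_of_eq ?_) (h₀ n' m' (fun i => prependZero a (x i))
      (fun j => prependZero b (y j)) ((monotone_prependZero ha).comp hx)
      ((monotone_prependZero hb).comp hy))
    refine Finset.sum_congr rfl fun i _ => Finset.sum_congr rfl fun j _ => ?_
    congr 2
    simp only [rect]
    ring

lemma tagSum_sub_left (r₀ r₀' r₁ : I → I → ℝ) (n m : ℕ) (a b s t : ℕ → I) :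
    tagSum (fun x y => r₀ x y - r₀' x y) r₁ n m a b s t =
      tagSum r₀ r₁ n m a b s t - tagSum r₀' r₁ n m a b s t := by
  simp only [tagSum, ← Finset.sum_sub_distrib, rect]
  exact Finset.sum_congr rfl fun i _ => Finset.sum_congr rfl fun j _ => by ring

lemma tagSum_sub_right (r₀ r₁ r₁' : I → I → ℝ) (n m : ℕ) (a b s t : ℕ → I) :
    tagSum r₀ (fun x y => r₁ x y - r₁' x y) n m a b s t =
      tagSum r₀ r₁ n m a b s t - tagSum r₀ r₁' n m a b s t := by
  simp only [tagSum, ← Finset.sum_sub_distrib, rect]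
  exact Finset.sum_congr rfl fun i _ => Finset.sum_congr rfl fun j _ => by ring

/-! ### From finite `p`-variation to bounds over monotone sequences -/

lemma exists_partition_sum_eq (n : ℕ) (x : ℕ → I) (hx : Monotone x) (h0 : x 0 = 0)
    (h1 : x n = 1) : ∃ D : Partition, ∀ g : I → I → ℝ, (∀ a, g a a = 0) →
      ∑ i ∈ Finset.range n, g (x i) (x (i + 1)) =
        ∑ i : Fin D.n, g (D.pt i.castSucc) (D.pt i.succ) := by
  induction n generalizing x with
  | zero => exact absurd (h0.symm.trans h1) (by simp)
  | succ m ih =>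
    by_cases hk : ∃ k ≤ m, x k = x (k + 1)
    · -- a repeated point is left out
      obtain ⟨k, hk, he⟩ := hk
      rcases hk.lt_or_eq with hlt | rfl
      · obtain ⟨l, rfl⟩ : ∃ l, m = l + 1 := ⟨m - 1, by omega⟩
        obtain ⟨D, hD⟩ := ih (fun j => x (skipSucc k j)) (hx.comp (monotone_skipSucc k))
          (by simpa [skipSucc] using h0) (by
            rw [skipSucc, if_neg (by omega), h1])
        refine ⟨D, fun g hg => ?_⟩
        rw [sum_range_skipSucc g x (Nat.lt_succ_iff.1 hlt), ← hD g hg, ← he, hg]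
        ring
      · obtain ⟨D, hD⟩ := ih x hx h0 (he.trans h1)
        refine ⟨D, fun g hg => ?_⟩
        rw [Finset.sum_range_succ, hD g hg, ← he, hg, add_zero]
    · push Not at hk
      refine ⟨⟨m + 1, fun i => x i, ?_, by simpa using h0, by simpa using h1⟩, fun g _ => ?_⟩
      · rw [Fin.strictMono_iff_lt_succ]
        intro i
        exact lt_of_le_of_ne (hx (by simp)) (by simpa using hk i (by omega))
      · rw [Finset.sum_range]
        simp

lemma exists_partition_sum_le (n : ℕ) (x : ℕ → I) (hx : Monotone x) :
    ∃ D : Partition, ∀ g : I → I → ℝ, (∀ a, g a a = 0) → (∀ a b, 0 ≤ g a b) →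
      ∑ i ∈ Finset.range n, g (x i) (x (i + 1)) ≤
        ∑ i : Fin D.n, g (D.pt i.castSucc) (D.pt i.succ) := by
  -- the end points `0` and `1` are added to the sequence
  let x' : ℕ → I := fun i => if i = 0 then 0 else if i ≤ n + 1 then x (i - 1) else 1
  have hx' : Monotone x' := by
    intro a b h
    simp only [x']
    split_ifs
    · exact le_rfl
    · exact unitInterval.nonneg'
    · exact unitInterval.nonneg'
    · omega
    · exact hx (by omega)
    · exact unitInterval.le_one'
    · omega
    · omega
    · exact le_rfl
  obtain ⟨D, hD⟩ := exists_partition_sum_eq (n + 2) x' hx' (by simp [x']) (by simp [x'])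
  refine ⟨D, fun g hg hg0 => ?_⟩
  rw [← hD g hg, Finset.sum_range_succ', Finset.sum_range_succ]
  have : ∀ i ∈ Finset.range n, g (x' (i + 1)) (x' (i + 1 + 1)) = g (x i) (x (i + 1)) := by
    intro i hi
    have := Finset.mem_range.1 hi
    simp only [x']
    rw [if_neg (by omega), if_pos (by omega), if_neg (by omega), if_pos (by omega)]
    rfl
  rw [Finset.sum_congr rfl this]
  linarith [hg0 (x' (n + 1)) (x' (n + 1 + 1)), hg0 (x' 0) (x' (0 + 1))]

lemma exists_varLE_of_pVariation_lt_top {f : I → I → ℝ} {p : ℝ} (hp : 0 < p)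
    (h : pVariation f p < ⊤) : ∃ K : ℝ, 0 < K ∧ VarLE f p K := by
  have hpart : ∀ D D' : Partition, ∑ i : Fin D.n, ∑ j : Fin D'.n, |D.cell D' f i j| ^ p ≤
      (pVariation f p ^ p).toReal := by
    intro D D'
    have h1 : (∑ i : Fin D.n, ∑ j : Fin D'.n, ‖D.cell D' f i j‖ₑ ^ p) ≤ pVariation f p ^ p := by
      rw [← ENNReal.rpow_inv_le_iff hp, ← one_div]
      exact le_iSup₂ (f := fun D D' : Partition =>
        (∑ i : Fin D.n, ∑ j : Fin D'.n, ‖D.cell D' f i j‖ₑ ^ p) ^ (1 / p)) D D'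
    have h2 : (∑ i : Fin D.n, ∑ j : Fin D'.n, ‖D.cell D' f i j‖ₑ ^ p) =
        ENNReal.ofReal (∑ i : Fin D.n, ∑ j : Fin D'.n, |D.cell D' f i j| ^ p) := by
      rw [ENNReal.ofReal_sum_of_nonneg fun i _ => by positivity]
      refine Finset.sum_congr rfl fun i _ => ?_
      rw [ENNReal.ofReal_sum_of_nonneg fun i _ => by positivity]
      refine Finset.sum_congr rfl fun j _ => ?_
      rw [← ENNReal.ofReal_rpow_of_nonneg (abs_nonneg _) hp.le, ← Real.enorm_abs,
        Real.enorm_of_nonneg (abs_nonneg _)]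
    rw [h2] at h1
    exact (ENNReal.ofReal_le_iff_le_toReal (ENNReal.rpow_ne_top_of_nonneg hp.le h.ne)).1 h1
  refine ⟨(pVariation f p ^ p).toReal + 1, by positivity, fun n m x y hx hy => ?_⟩
  obtain ⟨D, hD⟩ := exists_partition_sum_le n x hx
  obtain ⟨D', hD'⟩ := exists_partition_sum_le m y hy
  have h1 := hD (fun a b => ∑ j ∈ Finset.range m, |rect f a b (y j) (y (j + 1))| ^ p)
    (fun a => Finset.sum_eq_zero fun j _ => by
      simp [rect, Real.zero_rpow hp.ne']) (fun a b => by positivity)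
  have h2 : ∀ i : Fin D.n, _ := fun i => hD'
    (fun c d => |rect f (D.pt i.castSucc) (D.pt i.succ) c d| ^ p)
    (fun a => by simp [rect, Real.zero_rpow hp.ne']) (fun a b => by positivity)
  exact (h1.trans (Finset.sum_le_sum fun i _ => h2 i)).trans
    ((hpart D D').trans (by linarith))

/-! ### Rounding to dyadic points -/

/-- The largest multiple of `2⁻ᴺ` not exceeding `x`. -/
noncomputable def roundDown (N : ℕ) (x : I) : I :=
  ⟨(⌊(2 : ℝ) ^ N * x⌋₊ : ℝ) / 2 ^ N, by positivity, by
    rw [div_le_one (by positivity)]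
    have hx : (2 : ℝ) ^ N * x ≤ 2 ^ N := mul_le_of_le_one_right (by positivity) x.2.2
    exact (Nat.floor_le (by have := x.2.1; positivity)).trans hx⟩

lemma monotone_roundDown (N : ℕ) : Monotone (roundDown N) := by
  intro x y h
  rw [← Subtype.coe_le_coe]
  have : (x : ℝ) ≤ y := h
  simp only [roundDown]
  gcongr

lemma roundDown_zero (N : ℕ) : roundDown N 0 = 0 := by
  apply Subtype.ext
  simp [roundDown]

lemma abs_sub_roundDown_le (N : ℕ) (x : I) : |(x : ℝ) - roundDown N x| ≤ (1 / 2) ^ N := by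
  have h0 : (0 : ℝ) < 2 ^ N := by positivity
  have hx := x.2.1
  have h1 : (⌊(2 : ℝ) ^ N * x⌋₊ : ℝ) ≤ 2 ^ N * x := Nat.floor_le (by positivity)
  have h2 : (2 : ℝ) ^ N * x < ⌊(2 : ℝ) ^ N * x⌋₊ + 1 := Nat.lt_floor_add_one _
  have e : (x : ℝ) - roundDown N x = (2 ^ N * x - ⌊(2 : ℝ) ^ N * x⌋₊) / 2 ^ N := by
    simp only [roundDown]
    field_simp
  rw [e, abs_div, abs_of_nonneg (by linarith), abs_of_pos h0, one_div, inv_pow, ← one_div]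
  gcongr
  linarith

/-- The kernel `r` evaluated at the dyadic points of level `N` below its arguments. -/
noncomputable def roundKernel (N : ℕ) (r : I → I → ℝ) (x y : I) : ℝ :=
  r (roundDown N x) (roundDown N y)

/-- The dyadic point `k / 2ⁿ`, or `1` if `k` is too large. -/
noncomputable def dyPt (n k : ℕ) : I := ⟨min ((k : ℝ) / 2 ^ n) 1, by positivity, min_le_right _ _⟩

lemma monotone_dyPt (n : ℕ) : Monotone (dyPt n) := by
  intro k l h
  rw [← Subtype.coe_le_coe]
  have : (k : ℝ) ≤ l := by exact_mod_cast h
  simp only [dyPt]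
  gcongr

lemma dyPt_zero (n : ℕ) : dyPt n 0 = 0 := Subtype.ext (by simp [dyPt])

lemma coe_dyPt {n k : ℕ} (h : k ≤ 2 ^ n) : (dyPt n k : ℝ) = k / 2 ^ n := by
  have : (k : ℝ) ≤ 2 ^ n := by exact_mod_cast h
  simp only [dyPt]
  rw [min_eq_left]
  rwa [div_le_one (by positivity)]

lemma dyPt_last (n : ℕ) : dyPt n (2 ^ n) = 1 := Subtype.ext (by simp [dyPt])

lemma dyPt_val (n : ℕ) (k : Fin (2 ^ n + 1)) : dyPt n k = dyadic n k :=
  Subtype.ext (by rw [coe_dyPt (Nat.lt_succ_iff.1 k.2)]; rfl)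

lemma dyPt_succ_two_mul (n k : ℕ) : dyPt (n + 1) (2 * k) = dyPt n k := by
  apply Subtype.ext
  simp only [dyPt]
  congr 1
  push_cast
  rw [pow_succ]
  field_simp

lemma roundDown_dyPt_succ {N n k : ℕ} (hN : N ≤ n) (hk : k < 2 ^ n) :
    roundDown N (dyPt (n + 1) (2 * k + 1)) = roundDown N (dyPt n k) := by
  obtain ⟨j, rfl⟩ := Nat.exists_eq_add_of_le hN
  apply Subtype.ext
  simp only [roundDown]
  congr 2
  rw [coe_dyPt (by rw [pow_succ]; omega), coe_dyPt hk.le]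
  have e1 : (2 : ℝ) ^ N * (((2 * k + 1 : ℕ) : ℝ) / 2 ^ (N + j + 1)) =
      ((2 * k + 1 : ℕ) : ℝ) / ((2 * 2 ^ j : ℕ) : ℝ) := by
    push_cast
    rw [pow_succ, pow_add]
    field_simp
  have e2 : (2 : ℝ) ^ N * ((k : ℝ) / 2 ^ (N + j)) = (k : ℝ) / ((2 ^ j : ℕ) : ℝ) := by
    push_cast
    rw [pow_add]
    field_simp
  rw [e1, e2, Nat.floor_div_eq_div, Nat.floor_div_eq_div, ← Nat.div_div_eq_div_mul]
  congr 1
  omega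

lemma roundDown_dyPt_self {N k : ℕ} (hk : k ≤ 2 ^ N) : roundDown N (dyPt N k) = dyPt N k := by
  apply Subtype.ext
  simp only [roundDown]
  rw [coe_dyPt hk]
  have e : (2 : ℝ) ^ N * ((k : ℝ) / 2 ^ N) = k := by field_simp
  rw [e, Nat.floor_natCast]

/-! ### Rounding is a small perturbation in variation -/

lemma VarLE.sub {α : Type*} [Preorder α] {f g : α → α → ℝ} {p K L : ℝ} (hp : 0 ≤ p)
    (hf : VarLE f p K) (hg : VarLE g p L) :
    VarLE (fun x y => f x y - g x y) p (2 ^ p * (K + L)) := by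
  intro n m x y hx hy
  have hab : ∀ a b : ℝ, |a - b| ^ p ≤ 2 ^ p * (|a| ^ p + |b| ^ p) := by
    intro a b
    have h1 : |a - b| ≤ 2 * max |a| |b| := by
      have := abs_sub a b
      linarith [le_max_left |a| |b|, le_max_right |a| |b|]
    calc |a - b| ^ p ≤ (2 * max |a| |b|) ^ p := Real.rpow_le_rpow (abs_nonneg _) h1 hp
      _ = 2 ^ p * (max |a| |b|) ^ p := Real.mul_rpow (by norm_num) (by positivity)
      _ ≤ _ := by
        gcongr
        rcases max_choice |a| |b| with h | h <;> rw [h]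
        · linarith [Real.rpow_nonneg (abs_nonneg b) p]
        · linarith [Real.rpow_nonneg (abs_nonneg a) p]
  have h := add_le_add (hf n m x y hx hy) (hg n m x y hx hy)
  refine le_trans ?_ (mul_le_mul_of_nonneg_left h (by positivity : (0 : ℝ) ≤ 2 ^ p))
  rw [← Finset.sum_add_distrib, Finset.mul_sum]
  refine Finset.sum_le_sum fun i _ => ?_
  rw [← Finset.sum_add_distrib, Finset.mul_sum]
  refine Finset.sum_le_sum fun j _ => ?_
  refine le_trans (le_of_eq ?_) (hab _ _)
  congr 2
  ring

/-- Interpolation between the variation and the supremum norm. -/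
lemma VarLE.of_abs_le {α : Type*} [Preorder α] {f : α → α → ℝ} {p p' K M : ℝ} (hp : p < p')
    (hp0 : 0 < p) (hf : VarLE f p K) (hM : ∀ x y, |f x y| ≤ M) :
    VarLE f p' ((4 * M) ^ (p' - p) * K) := by
  intro n m x y hx hy
  have hz : ∀ i j, |f (x (i + 1)) (y (j + 1)) - f (x (i + 1)) (y j) - f (x i) (y (j + 1)) +
      f (x i) (y j)| ≤ 4 * M := by
    intro i j
    have h1 := abs_le.1 (hM (x (i + 1)) (y (j + 1)))
    have h2 := abs_le.1 (hM (x (i + 1)) (y j))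
    have h3 := abs_le.1 (hM (x i) (y (j + 1)))
    have h4 := abs_le.1 (hM (x i) (y j))
    rw [abs_le]
    constructor <;> linarith
  have hM0 : 0 ≤ 4 * M := (abs_nonneg _).trans (hz 0 0)
  refine le_trans ?_ (mul_le_mul_of_nonneg_left (hf n m x y hx hy)
    (by positivity : 0 ≤ (4 * M) ^ (p' - p)))
  rw [Finset.mul_sum]
  refine Finset.sum_le_sum fun i _ => ?_
  rw [Finset.mul_sum]
  refine Finset.sum_le_sum fun j _ => ?_
  set z := |f (x (i + 1)) (y (j + 1)) - f (x (i + 1)) (y j) - f (x i) (y (j + 1)) + f (x i) (y j)|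
  have hz0 : 0 ≤ z := abs_nonneg _
  calc z ^ p' = z ^ (p' - p) * z ^ p := by
        rw [← Real.rpow_add' hz0 (by linarith)]
        congr 1
        ring
    _ ≤ _ := by
        gcongr
        · exact hz i j

lemma exists_varLE_sub_roundKernel {r : I → I → ℝ} {p p' K : ℝ} (hp : p < p') (hp0 : 0 < p)
    (hr : Continuous fun z : I × I => r z.1 z.2) (hK : VarLE r p K) (hK0 : 0 < K) {η : ℝ}
    (hη : 0 < η) :
    ∃ N₀, ∀ N ≥ N₀, VarLE (fun x y => r x y - roundKernel N r x y) p' η := by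
  -- the interpolation bound is `(4 M) ^ (p' - p) * K'`, where `M` bounds the rounding error
  set K' := 2 ^ p * (K + K) with hK'
  have hK'0 : 0 < K' := by positivity
  set M : ℝ := (η / K') ^ (p' - p)⁻¹ / 4 with hM
  have hM0 : 0 < M := by positivity
  have hpp : 0 < p' - p := sub_pos.2 hp
  have hMη : (4 * M) ^ (p' - p) * K' = η := by
    rw [hM, mul_div_cancel₀ _ (by norm_num : (4 : ℝ) ≠ 0), Real.rpow_inv_rpow (by positivity)
      hpp.ne', div_mul_cancel₀ _ hK'0.ne']
  obtain ⟨δ, hδ, hu⟩ := Metric.uniformContinuous_iff.1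
    (CompactSpace.uniformContinuous_of_continuous hr) M hM0
  obtain ⟨N₀, hN₀⟩ := exists_pow_lt_of_lt_one hδ (by norm_num : (1 / 2 : ℝ) < 1)
  refine ⟨N₀, fun N hN => ?_⟩
  have hsub := VarLE.sub hp0.le hK
    (hK.comp (monotone_roundDown N) (monotone_roundDown N))
  rw [← hMη]
  refine VarLE.of_abs_le hp hp0 hsub fun x y => ?_
  have hd : ∀ z : I, dist z (roundDown N z) < δ := by
    intro z
    rw [Subtype.dist_eq, Real.dist_eq]
    calc _ ≤ (1 / 2 : ℝ) ^ N := abs_sub_roundDown_le N z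
      _ ≤ (1 / 2 : ℝ) ^ N₀ := pow_le_pow_of_le_one (by norm_num) (by norm_num) hN
      _ < δ := hN₀
  have := hu (a := (x, y)) (b := (roundDown N x, roundDown N y))
    (by rw [Prod.dist_eq]; exact max_lt (hd x) (hd y))
  rw [Real.dist_eq] at this
  exact this.le

lemma exists_larger_exponent {p q : ℝ} (hp : 0 < p) (hq : 1 ≤ q) (hpq : 1 < p⁻¹ + q⁻¹) :
    ∃ p', p < p' ∧ 1 < p'⁻¹ + q⁻¹ := by
  have hq1 : q⁻¹ ≤ 1 := inv_le_one_of_one_le₀ hq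
  have hp0 : 0 < p⁻¹ := inv_pos.2 hp
  refine ⟨((p⁻¹ + (1 - q⁻¹)) / 2)⁻¹, ?_, ?_⟩
  · rw [lt_inv_comm₀ hp (by linarith)]
    linarith
  · rw [inv_inv]
    linarith

/-- Rounding the kernels of a tagged sum changes it by little, uniformly over all grids. -/
lemma exists_abs_tagSum_sub_le {p q : ℝ} (hp : 1 ≤ p) (hq : 1 ≤ q) (hpq : 1 < p⁻¹ + q⁻¹)
    {r₀ r₁ : I → I → ℝ} (hr₀ : Continuous fun z : I × I => r₀ z.1 z.2)
    (hr₁ : Continuous fun z : I × I => r₁ z.1 z.2) {K L : ℝ} (hK : 0 < K) (hL : 0 < L)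
    (h₀ : VarLE r₀ p K) (h₁ : VarLE r₁ q L) {ε : ℝ} (hε : 0 < ε) :
    ∃ N₀, ∀ N ≥ N₀, ∀ (n m : ℕ) (a b s t : ℕ → I), Monotone a → Monotone b → Monotone s →
      Monotone t →
      |tagSum r₀ r₁ n m a b s t - tagSum (roundKernel N r₀) r₁ n m a b s t| ≤ ε ∧
      |tagSum r₀ r₁ n m a b s t -
        tagSum (roundKernel N r₀) (roundKernel N r₁) n m a b s t| ≤ ε := by
  have hp0 : 0 < p := by linarith
  have hq0 : 0 < q := by linarith
  obtain ⟨p', hpp', hp'⟩ := exists_larger_exponent hp0 hq hpq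
  obtain ⟨q', hqq', hq'⟩ := exists_larger_exponent hq0 hp (by rwa [add_comm])
  rw [add_comm] at hq'
  obtain ⟨C, hC, hCb⟩ := abs_tagSum_le (hp0.trans hpp') hq0 hp'
  obtain ⟨C', hC', hCb'⟩ := abs_tagSum_le hp0 (hq0.trans hqq') hq'
  have small : ∀ {A s : ℝ}, 0 ≤ A → 0 < s → ∃ η : ℝ, 0 < η ∧ A * η ^ s⁻¹ ≤ ε / 2 := by
    intro A s hA hs
    refine ⟨(ε / 2 / (A + 1)) ^ s, by positivity, ?_⟩
    rw [Real.rpow_rpow_inv (by positivity) hs.ne', mul_div_assoc', div_le_iff₀ (by positivity)]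
    nlinarith
  obtain ⟨η, hη, hηε⟩ := small (A := C * L ^ q⁻¹) (by positivity) (hp0.trans hpp')
  obtain ⟨η', hη', hηε'⟩ := small (A := C' * K ^ p⁻¹) (by positivity) (hq0.trans hqq')
  obtain ⟨N₁, hN₁⟩ := exists_varLE_sub_roundKernel hpp' hp0 hr₀ h₀ hK hη
  obtain ⟨N₂, hN₂⟩ := exists_varLE_sub_roundKernel hqq' hq0 hr₁ h₁ hL hη'
  refine ⟨max N₁ N₂, fun N hN n m a b s t ha hb hs ht => ?_⟩
  have e1 := hCb η L _ r₁ hη hL (hN₁ N (le_of_max_le_left hN)) h₁ n m a b s t ha hb hs ht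
  have e2 := hCb' K η' (roundKernel N r₀) _ hK hη'
    (h₀.comp (monotone_roundDown N) (monotone_roundDown N)) (hN₂ N (le_of_max_le_right hN))
    n m a b s t ha hb hs ht
  rw [tagSum_sub_left] at e1
  rw [tagSum_sub_right] at e2
  have e3 : C * (η ^ p'⁻¹ * L ^ q⁻¹) ≤ ε / 2 := by linarith
  have e4 : C' * (K ^ p⁻¹ * η' ^ q'⁻¹) ≤ ε / 2 := by linarith
  have f1 := e1.trans e3
  have f2 := e2.trans e4
  refine ⟨by linarith, ?_⟩
  calc _ ≤ _ := abs_sub_le _ (tagSum (roundKernel N r₀) r₁ n m a b s t) _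
    _ ≤ ε := by linarith

/-! ### The dyadic Lévy form -/

/-- The value of the Lévy kernel on the product of the `k`-th and the `l`-th dyadic interval. -/
noncomputable def levySign (k l : ℕ) : ℝ := if k < l then 1 / 2 else if l < k then -(1 / 2) else 0

lemma levySign_swap (k l : ℕ) : levySign k l = -levySign l k := by
  rcases lt_trichotomy k l with h | h | h
  · simp [levySign, h, not_lt.2 h.le]
  · simp [levySign, h]
  · simp [levySign, h, not_lt.2 h.le]

lemma sum_levySign_mul (u : ℕ → ℝ) {l M : ℕ} (hl : l < M) :
    ∑ k ∈ Finset.range M, levySign k l * (u (k + 1) - u k) =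
      1 / 2 * (u l + u (l + 1) - u 0 - u M) := by
  obtain ⟨m, rfl⟩ := Nat.exists_eq_add_of_le (Nat.succ_le_of_lt hl)
  rw [Finset.sum_range_add, Finset.sum_range_succ]
  have h1 : ∀ k ∈ Finset.range l, levySign k l * (u (k + 1) - u k) =
      1 / 2 * (u (k + 1) - u k) := by
    intro k hk
    rw [levySign, if_pos (Finset.mem_range.1 hk)]
  have h2 : ∀ k ∈ Finset.range m, levySign (l + 1 + k) l *
      (u (l + 1 + k + 1) - u (l + 1 + k)) = -(1 / 2) * (u (l + 1 + (k + 1)) - u (l + 1 + k)) := by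
    intro k _
    rw [levySign, if_neg (by omega), if_pos (by omega)]
    rfl
  rw [Finset.sum_congr rfl h1, Finset.sum_congr rfl h2, ← Finset.mul_sum, ← Finset.mul_sum,
    Finset.sum_range_sub, Finset.sum_range_sub (fun k => u (l + 1 + k)), levySign,
    if_neg (lt_irrefl _), if_neg (lt_irrefl _)]
  simp only [add_zero, Nat.succ_eq_add_one]
  ring

/-- The integral of the dyadic Lévy kernel against `dy ⊗ dw`. -/
noncomputable def levyForm (n : ℕ) (y w : I → ℝ) : ℝ :=
  ∑ k ∈ Finset.range (2 ^ n), ∑ l ∈ Finset.range (2 ^ n), levySign k l *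
    ((y (dyPt n (k + 1)) - y (dyPt n k)) * (w (dyPt n (l + 1)) - w (dyPt n l)))

lemma levyForm_swap (n : ℕ) (y w : I → ℝ) : levyForm n y w = -levyForm n w y := by
  simp only [levyForm]
  rw [Finset.sum_comm]
  simp only [← Finset.sum_neg_distrib]
  refine Finset.sum_congr rfl fun k _ => Finset.sum_congr rfl fun l _ => ?_
  rw [levySign_swap]
  ring

lemma levyForm_zero_left (n : ℕ) (w : I → ℝ) : levyForm n 0 w = 0 := by
  simp [levyForm]

lemma levyForm_eq (n : ℕ) (y w : I → ℝ) :
    levyForm n y w = ∑ l ∈ Finset.range (2 ^ n),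
      1 / 2 * (y (dyPt n l) + y (dyPt n (l + 1)) - y 0 - y 1) *
        (w (dyPt n (l + 1)) - w (dyPt n l)) := by
  rw [levyForm, Finset.sum_comm]
  refine Finset.sum_congr rfl fun l hl => ?_
  have := sum_levySign_mul (fun k => y (dyPt n k)) (Finset.mem_range.1 hl)
  simp only [dyPt_zero, dyPt_last] at this
  rw [← this, Finset.sum_mul]
  exact Finset.sum_congr rfl fun k _ => by ring

lemma sum_range_two_mul {M : Type*} [AddCommMonoid M] (n : ℕ) (g : ℕ → M) :
    ∑ k ∈ Finset.range (2 * n), g k =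
      ∑ k ∈ Finset.range n, (g (2 * k) + g (2 * k + 1)) := by
  induction n with
  | zero => simp
  | succ n ih =>
    rw [show 2 * (n + 1) = 2 * n + 1 + 1 by ring, Finset.sum_range_succ, Finset.sum_range_succ, ih,
      Finset.sum_range_succ, add_assoc]

lemma levyForm_roundDown_succ {N n : ℕ} (h : N ≤ n) (y w : I → ℝ) :
    levyForm (n + 1) (y ∘ roundDown N) (w ∘ roundDown N) =
      levyForm n (y ∘ roundDown N) (w ∘ roundDown N) := by
  have e0 : ∀ (y : I → ℝ) {k : ℕ}, k ∈ Finset.range (2 ^ n) →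
      (y ∘ roundDown N) (dyPt (n + 1) (2 * k + 1)) - (y ∘ roundDown N) (dyPt (n + 1) (2 * k)) =
        0 := by
    intro y k hk
    rw [Function.comp_apply, Function.comp_apply, roundDown_dyPt_succ h (Finset.mem_range.1 hk),
      dyPt_succ_two_mul, sub_self]
  have e1 : ∀ (y : I → ℝ) {k : ℕ}, k ∈ Finset.range (2 ^ n) →
      (y ∘ roundDown N) (dyPt (n + 1) (2 * k + 1 + 1)) -
        (y ∘ roundDown N) (dyPt (n + 1) (2 * k + 1)) =
      (y ∘ roundDown N) (dyPt n (k + 1)) - (y ∘ roundDown N) (dyPt n k) := by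
    intro y k hk
    rw [show 2 * k + 1 + 1 = 2 * (k + 1) by ring, dyPt_succ_two_mul, Function.comp_apply,
      Function.comp_apply, roundDown_dyPt_succ h (Finset.mem_range.1 hk)]
    rfl
  have es : ∀ k l : ℕ, levySign (2 * k + 1) (2 * l + 1) = levySign k l := by
    intro k l
    simp only [levySign]
    congr 1
    · simp
    · simp
  rw [levyForm, levyForm, pow_succ, mul_comm (2 ^ n) 2, sum_range_two_mul]
  refine Finset.sum_congr rfl fun k hk => ?_
  rw [sum_range_two_mul, sum_range_two_mul, ← Finset.sum_add_distrib]
  refine Finset.sum_congr rfl fun l hl => ?_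
  rw [e0 y hk, e0 w hl, e1 y hk, e1 w hl, es]
  ring

/-- At all levels `n ≥ N`, the Lévy form sees functions rounded to level `N` as at level `N`: the
jumps of such functions in the same interval of level `N` occupy the same interval of level `n`,
where the kernel vanishes. -/
lemma levyForm_roundDown {N n : ℕ} (h : N ≤ n) (y w : I → ℝ) :
    levyForm n (y ∘ roundDown N) (w ∘ roundDown N) = levyForm N y w := by
  induction n, h using Nat.le_induction with
  | base =>
    refine Finset.sum_congr rfl fun k hk => Finset.sum_congr rfl fun l hl => ?_
    have hk' := Finset.mem_range.1 hk
    have hl' := Finset.mem_range.1 hl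
    simp only [Function.comp_apply]
    rw [roundDown_dyPt_self hk', roundDown_dyPt_self hl', roundDown_dyPt_self hk'.le,
      roundDown_dyPt_self hl'.le]
  | succ n hn ih => rw [levyForm_roundDown_succ hn, ih]

/-- The integral of the product of the dyadic Lévy kernels of levels `n` and `m` against
`dr₀ ⊗ dr₁`, where `r₀` pairs the first variables of the kernels and `r₁` the second ones. -/
noncomputable def levyGram (n m : ℕ) (r₀ r₁ : I → I → ℝ) : ℝ :=
  ∑ k ∈ Finset.range (2 ^ n), ∑ l ∈ Finset.range (2 ^ n), levySign k l *
    levyForm m (fun v => r₀ (dyPt n (k + 1)) v - r₀ (dyPt n k) v)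
      (fun v => r₁ (dyPt n (l + 1)) v - r₁ (dyPt n l) v)

lemma levyGram_swap (n m : ℕ) (r₀ r₁ : I → I → ℝ) :
    levyGram n m r₀ r₁ = levyGram m n (fun x y => r₀ y x) (fun x y => r₁ y x) := by
  simp only [levyGram, levyForm, Finset.mul_sum]
  calc _ = ∑ k ∈ Finset.range (2 ^ n), ∑ k' ∈ Finset.range (2 ^ m),
        ∑ l ∈ Finset.range (2 ^ n), ∑ l' ∈ Finset.range (2 ^ m), _ :=
        Finset.sum_congr rfl fun k _ => Finset.sum_comm
    _ = ∑ k' ∈ Finset.range (2 ^ m), ∑ k ∈ Finset.range (2 ^ n),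
        ∑ l' ∈ Finset.range (2 ^ m), ∑ l ∈ Finset.range (2 ^ n), _ := by
        rw [Finset.sum_comm]
        exact Finset.sum_congr rfl fun k _ => Finset.sum_congr rfl fun l _ => Finset.sum_comm
    _ = ∑ k' ∈ Finset.range (2 ^ m), ∑ l' ∈ Finset.range (2 ^ m),
        ∑ k ∈ Finset.range (2 ^ n), ∑ l ∈ Finset.range (2 ^ n), _ :=
        Finset.sum_congr rfl fun k _ => Finset.sum_comm
    _ = _ := by
        refine Finset.sum_congr rfl fun k' _ => Finset.sum_congr rfl fun l' _ =>
          Finset.sum_congr rfl fun k _ => Finset.sum_congr rfl fun l _ => ?_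
        ring

lemma levyGram_roundKernel {N n m : ℕ} (hn : N ≤ n) (hm : N ≤ m) (r₀ r₁ : I → I → ℝ) :
    levyGram n m (roundKernel N r₀) (roundKernel N r₁) = levyGram N N r₀ r₁ := by
  have h : ∀ {n m : ℕ}, N ≤ m → ∀ r₀ r₁ : I → I → ℝ,
      levyGram n m (fun x y => r₀ x (roundDown N y)) (fun x y => r₁ x (roundDown N y)) =
        levyGram n N r₀ r₁ := by
    intro n m hm r₀ r₁
    refine Finset.sum_congr rfl fun k _ => Finset.sum_congr rfl fun l _ => ?_
    rw [← levyForm_roundDown hm]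
    rfl
  refine (h hm (fun x y => r₀ (roundDown N x) y) (fun x y => r₁ (roundDown N x) y)).trans ?_
  rw [levyGram_swap, h hn (fun x y => r₀ y x) (fun x y => r₁ y x), levyGram_swap]

lemma levyGram_eq_sum (n m : ℕ) (r₀ r₁ : I → I → ℝ) :
    levyGram n m r₀ r₁ = ∑ l ∈ Finset.range (2 ^ n), ∑ l' ∈ Finset.range (2 ^ m),
      1 / 4 * (rect r₀ 0 (dyPt n l) 0 (dyPt m l') + rect r₀ 0 (dyPt n l) 0 (dyPt m (l' + 1))
        - rect r₀ 0 (dyPt n l) 0 1 + rect r₀ 0 (dyPt n (l + 1)) 0 (dyPt m l')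
        + rect r₀ 0 (dyPt n (l + 1)) 0 (dyPt m (l' + 1)) - rect r₀ 0 (dyPt n (l + 1)) 0 1
        - rect r₀ 0 1 0 (dyPt m l') - rect r₀ 0 1 0 (dyPt m (l' + 1)) + rect r₀ 0 1 0 1) *
      rect r₁ (dyPt n l) (dyPt n (l + 1)) (dyPt m l') (dyPt m (l' + 1)) := by
  have h1 : levyGram n m r₀ r₁ = ∑ l' ∈ Finset.range (2 ^ m),
      levyForm n (fun u => 1 / 2 * (r₀ u (dyPt m l') + r₀ u (dyPt m (l' + 1)) - r₀ u 0 - r₀ u 1))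
        (fun u => r₁ u (dyPt m (l' + 1)) - r₁ u (dyPt m l')) := by
    simp only [levyGram, levyForm_eq m, Finset.mul_sum]
    rw [Finset.sum_congr rfl fun k _ => Finset.sum_comm, Finset.sum_comm]
    refine Finset.sum_congr rfl fun l' _ => ?_
    rw [levyForm]
    refine Finset.sum_congr rfl fun k _ => Finset.sum_congr rfl fun l _ => ?_
    ring
  rw [h1, Finset.sum_comm]
  refine Finset.sum_congr rfl fun l' _ => ?_
  rw [levyForm_eq]
  refine Finset.sum_congr rfl fun l _ => ?_
  simp only [rect]
  ring

lemma levyGram_eq_tagSum (n m : ℕ) (r₀ r₁ : I → I → ℝ) :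
    levyGram n m r₀ r₁ = 1 / 4 * ∑ c : Fin 3, ∑ d : Fin 3, (![1, 1, -1] c * ![1, 1, -1] d) *
      tagSum r₀ r₁ (2 ^ n) (2 ^ m) (![dyPt n, fun l => dyPt n (l + 1), fun _ => 1] c)
        (![dyPt m, fun l => dyPt m (l + 1), fun _ => 1] d) (dyPt n) (dyPt m) := by
  rw [levyGram_eq_sum]
  simp only [tagSum, Finset.mul_sum, Fin.sum_univ_three, Matrix.cons_val_zero, Matrix.cons_val_one,
    Matrix.cons_val, ← Finset.sum_add_distrib]
  refine Finset.sum_congr rfl fun l _ => Finset.sum_congr rfl fun l' _ => ?_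
  ring

/-- The Gram coefficients of the dyadic Lévy kernels converge as both levels tend to infinity. -/
lemma exists_abs_levyGram_sub_le {p q : ℝ} (hp : 1 ≤ p) (hq : 1 ≤ q) (hpq : 1 < p⁻¹ + q⁻¹)
    {r₀ r₁ : I → I → ℝ} (hr₀ : Continuous fun z : I × I => r₀ z.1 z.2)
    (hr₁ : Continuous fun z : I × I => r₁ z.1 z.2) {K L : ℝ} (hK : 0 < K) (hL : 0 < L)
    (h₀ : VarLE r₀ p K) (h₁ : VarLE r₁ q L) {ε : ℝ} (hε : 0 < ε) :
    ∃ N, ∀ n ≥ N, ∀ m ≥ N, |levyGram n m r₀ r₁ - levyGram N N r₀ r₁| ≤ ε := by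
  obtain ⟨N, hN⟩ := exists_abs_tagSum_sub_le hp hq hpq hr₀ hr₁ hK hL h₀ h₁
    (ε := 4 / 9 * ε) (by positivity)
  refine ⟨N, fun n hn m hm => ?_⟩
  have hmono : ∀ (n : ℕ) (c : Fin 3),
      Monotone ((![dyPt n, fun l => dyPt n (l + 1), fun _ => 1] : Fin 3 → ℕ → I) c) := by
    intro n c
    fin_cases c
    · exact monotone_dyPt n
    · exact fun a b h => monotone_dyPt n (by omega)
    · exact monotone_const
  rw [← levyGram_roundKernel hn hm, levyGram_eq_tagSum, levyGram_eq_tagSum, ← mul_sub, abs_mul,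
    ← Finset.sum_sub_distrib]
  have hc : ∀ c d : Fin 3, |(![1, 1, -1] : Fin 3 → ℝ) c * (![1, 1, -1] : Fin 3 → ℝ) d| = 1 := by
    intro c d
    fin_cases c <;> fin_cases d <;> norm_num
  calc _ ≤ |(1 / 4 : ℝ)| * ∑ c : Fin 3, ∑ d : Fin 3, 4 / 9 * ε := by
        gcongr
        refine (Finset.abs_sum_le_sum_abs _ _).trans (Finset.sum_le_sum fun c _ => ?_)
        rw [← Finset.sum_sub_distrib]
        refine (Finset.abs_sum_le_sum_abs _ _).trans (Finset.sum_le_sum fun d _ => ?_)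
        rw [← mul_sub, abs_mul, hc, one_mul]
        exact (hN N le_rfl _ _ _ _ _ _ (hmono n c) (hmono m d) (monotone_dyPt n)
          (monotone_dyPt m)).2
    _ = ε := by
        rw [abs_of_pos (by norm_num)]
        simp
        ring

/-! ### Inner products with the dyadic approximations -/

lemma inner_toHSq_tmul {R : Fin 2 → CovKernel} (f g f' g' : StepPair R) :
    inner ℝ (StepSq.toHSq (f ⊗ₜ[ℝ] g)) (StepSq.toHSq (f' ⊗ₜ[ℝ] g')) =
      inner ℝ f f' * inner ℝ g g' := by
  simp [StepSq.toHSq]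

/-- The function `s ↦ ∫ f(t, i) Rᵢ(s, dt)`, which represents the inner product with `f` on the
indicators of intervals. -/
noncomputable def potential {R : Fin 2 → CovKernel} (i : Fin 2) (f : StepPair R) (s : I) : ℝ :=
  stepInt (fun t => (R i).toFun s t) (f i)

/-- The indicator of `(a, b]` on the `i`-th copy of `[0, 1]`. -/
noncomputable def pairInd (R : Fin 2 → CovKernel) (i : Fin 2) (a b : I) : StepPair R :=
  Pi.single i (stepInd a b)

lemma pairInd_same (R : Fin 2 → CovKernel) (i : Fin 2) (a b : I) :
    pairInd R i a b i = stepInd a b :=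
  Pi.single_eq_same (M := fun _ => StepFun) i _

lemma pairInd_ne (R : Fin 2 → CovKernel) {i j : Fin 2} (h : j ≠ i) (a b : I) :
    pairInd R i a b j = 0 :=
  Pi.single_eq_of_ne (M := fun _ => StepFun) h _

lemma inner_pairInd {R : Fin 2 → CovKernel} (i : Fin 2) {a b : I} (h : a ≤ b) (f : StepPair R) :
    inner ℝ (pairInd R i a b) f = potential i f b - potential i f a := by
  rw [inner_stepPair, Finset.sum_eq_single i]
  · rw [pairInd_same, stepForm, stepInt_stepInd _ h]
    rfl
  · intro j _ hj
    rw [pairInd_ne R hj, stepForm, map_zero]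
  · simp

lemma potential_pairInd_same {R : Fin 2 → CovKernel} (i : Fin 2) {a b : I} (h : a ≤ b) :
    potential i (pairInd R i a b) = fun s => (R i).toFun s b - (R i).toFun s a := by
  funext s
  rw [potential, pairInd_same, stepInt_stepInd _ h]

lemma potential_pairInd_ne {R : Fin 2 → CovKernel} {i j : Fin 2} (h : j ≠ i) (a b : I) :
    potential j (pairInd R i a b) = 0 := by
  funext s
  rw [potential, pairInd_ne R h, map_zero]
  rfl

lemma levyStep_eq_sum (R : Fin 2 → CovKernel) (n : ℕ) :
    levyStep R n = ∑ k ∈ Finset.range (2 ^ n), ∑ l ∈ Finset.range (2 ^ n), levySign k l •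
      (pairInd R 0 (dyPt n k) (dyPt n (k + 1)) ⊗ₜ[ℝ] pairInd R 1 (dyPt n l) (dyPt n (l + 1)) -
       pairInd R 1 (dyPt n k) (dyPt n (k + 1)) ⊗ₜ[ℝ] pairInd R 0 (dyPt n l) (dyPt n (l + 1))) := by
  simp only [Finset.sum_range, levyStep]
  refine Finset.sum_congr rfl fun k _ => Finset.sum_congr rfl fun l _ => ?_
  have h : ∀ (k : Fin (2 ^ n)) (i : Fin 2),
      dyadicInd R n k i = pairInd R i (dyPt n k) (dyPt n (k + 1)) := by
    intro k i
    rw [dyadicInd, ← dyPt_val, ← dyPt_val]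
    rfl
  simp only [h, levySign, Fin.lt_def]
  split_ifs with h1 h2
  · rfl
  · rw [neg_smul, ← smul_neg, neg_sub]
  · rw [zero_smul]

lemma inner_toHSq_levyStep_tmul {R : Fin 2 → CovKernel} (n : ℕ) (f g : StepPair R) :
    inner ℝ (StepSq.toHSq (levyStep R n)) (StepSq.toHSq (f ⊗ₜ[ℝ] g)) =
      levyForm n (potential 0 f) (potential 1 g) - levyForm n (potential 1 f) (potential 0 g) := by
  have hle : ∀ k, dyPt n k ≤ dyPt n (k + 1) := fun k => monotone_dyPt n (Nat.le_succ k)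
  simp only [levyStep_eq_sum, map_sum, map_smul, map_sub, sum_inner, inner_sub_left,
    real_inner_smul_left, inner_toHSq_tmul, inner_pairInd _ (hle _), levyForm,
    ← Finset.sum_sub_distrib, mul_sub]

lemma inner_toHSq_levyStep_levyStep (R : Fin 2 → CovKernel) (n m : ℕ) :
    inner ℝ (StepSq.toHSq (levyStep R n)) (StepSq.toHSq (levyStep R m)) =
      2 * levyGram n m (R 0).toFun (R 1).toFun := by
  have hle : ∀ k, dyPt m k ≤ dyPt m (k + 1) := fun k => monotone_dyPt m (Nat.le_succ k)
  rw [levyStep_eq_sum R m]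
  simp only [map_sum, map_smul, map_sub, inner_sum, inner_sub_right, real_inner_smul_right,
    inner_toHSq_levyStep_tmul, potential_pairInd_same _ (hle _),
    potential_pairInd_ne (show (1 : Fin 2) ≠ 0 by decide),
    potential_pairInd_ne (show (0 : Fin 2) ≠ 1 by decide), levyForm_zero_left, zero_sub, sub_zero,
    sub_neg_eq_add, mul_add, Finset.sum_add_distrib]
  rw [levyGram_swap, two_mul, levyGram]
  congr 1
  rw [Finset.sum_comm]
  refine Finset.sum_congr rfl fun k _ => Finset.sum_congr rfl fun l _ => ?_
  rw [levyForm_swap, levySign_swap]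
  ring

/-- The dyadic approximations of the Lévy kernel form a Cauchy sequence: their mutual inner products
have a common limit. -/
lemma cauchySeq_toHSq_levyStep {R : Fin 2 → CovKernel} {p q : ℝ} (hp : 1 ≤ p) (hq : 1 ≤ q)
    (hpq : 1 < p⁻¹ + q⁻¹) (hc : ∀ i, Continuous fun z : I × I => (R i).toFun z.1 z.2) {K L : ℝ}
    (hK : 0 < K) (hL : 0 < L) (h₀ : VarLE (R 0).toFun p K) (h₁ : VarLE (R 1).toFun q L) :
    CauchySeq (fun n : ℕ => StepSq.toHSq (levyStep R n)) := by
  rw [Metric.cauchySeq_iff]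
  intro ε hε
  obtain ⟨N, hN⟩ := exists_abs_levyGram_sub_le hp hq hpq (hc 0) (hc 1) hK hL h₀ h₁
    (ε := ε ^ 2 / 16) (by positivity)
  refine ⟨N, fun m hm n hn => ?_⟩
  rw [dist_eq_norm]
  refine lt_of_pow_lt_pow_left₀ 2 hε.le ?_
  rw [@norm_sub_sq_real, ← real_inner_self_eq_norm_sq, ← real_inner_self_eq_norm_sq,
    inner_toHSq_levyStep_levyStep, inner_toHSq_levyStep_levyStep, inner_toHSq_levyStep_levyStep]
  have h1 := abs_le.1 (hN m hm m hm)
  have h2 := abs_le.1 (hN m hm n hn)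
  have h3 := abs_le.1 (hN n hn n hn)
  have h4 : 0 < ε ^ 2 := by positivity
  linarith

/-- The dyadic approximations are symmetric tensors. -/
lemma toHSq_levyStep_mem_HSym (R : Fin 2 → CovKernel) (n : ℕ) :
    StepSq.toHSq (levyStep R n) ∈ HSym R := by
  have hsq : ∀ f : StepPair R, StepSq.toHSq (f ⊗ₜ[ℝ] f) ∈ HSym R := fun f =>
    Submodule.le_topologicalClosure _ (Submodule.subset_span ⟨(f : HSpace R), rfl⟩)
  have hsymm : ∀ f g : StepPair R, StepSq.toHSq (f ⊗ₜ[ℝ] g + g ⊗ₜ[ℝ] f) ∈ HSym R := by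
    intro f g
    have e : f ⊗ₜ[ℝ] g + g ⊗ₜ[ℝ] f =
        (f + g) ⊗ₜ[ℝ] (f + g) - f ⊗ₜ[ℝ] f - g ⊗ₜ[ℝ] g := by
      rw [TensorProduct.add_tmul, TensorProduct.tmul_add, TensorProduct.tmul_add]
      abel
    rw [e, map_sub, map_sub]
    exact Submodule.sub_mem _ (Submodule.sub_mem _ (hsq _) (hsq _)) (hsq _)
  have e : levyStep R n = ∑ k ∈ Finset.range (2 ^ n), ∑ l ∈ Finset.range (2 ^ n), levySign k l •
      (pairInd R 0 (dyPt n k) (dyPt n (k + 1)) ⊗ₜ[ℝ] pairInd R 1 (dyPt n l) (dyPt n (l + 1)) +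
       pairInd R 1 (dyPt n l) (dyPt n (l + 1)) ⊗ₜ[ℝ] pairInd R 0 (dyPt n k) (dyPt n (k + 1))) := by
    rw [levyStep_eq_sum]
    simp only [smul_add, Finset.sum_add_distrib, sub_eq_add_neg]
    congr 1
    rw [Finset.sum_comm]
    refine Finset.sum_congr rfl fun k _ => Finset.sum_congr rfl fun l _ => ?_
    rw [levySign_swap, smul_neg, neg_smul, neg_neg]
  rw [e, map_sum]
  refine Submodule.sum_mem _ fun k _ => ?_
  rw [map_sum]
  refine Submodule.sum_mem _ fun l _ => ?_
  rw [map_smul]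
  exact Submodule.smul_mem _ _ (hsymm _ _)

/-! ### Tagged grids -/

/-- The first `n` intervals of the sequence `s` form a partition of `[0, 1]` (which may have
degenerate intervals) of mesh less than `δ`, and `a` chooses a point in every interval. -/
structure IsTaggedGrid (δ : ℝ) (n : ℕ) (s a : ℕ → I) : Prop where
  zero : s 0 = 0
  last : s n = 1
  mono : Monotone s
  tag : ∀ i, a i ∈ Set.Icc (s i) (s (i + 1))
  mesh : ∀ i, (s (i + 1) : ℝ) - s i < δ

lemma IsTaggedGrid.mono_tag {δ : ℝ} {n : ℕ} {s a : ℕ → I} (h : IsTaggedGrid δ n s a) :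
    Monotone a :=
  monotone_nat_of_le_succ fun i => (h.tag i).2.trans (h.tag (i + 1)).1

/-- The points of a partition as a sequence which is eventually equal to `1`. -/
def partSeq (D : Partition) (i : ℕ) : I := D.pt ⟨min i D.n, by omega⟩

/-- Tags of a partition as a sequence which is eventually equal to `1`. -/
noncomputable def tagSeq (D : Partition) (ξ : Fin D.n → I) (i : ℕ) : I :=
  if h : i < D.n then ξ ⟨i, h⟩ else 1

lemma partSeq_castSucc (D : Partition) (i : Fin D.n) : partSeq D i = D.pt i.castSucc := by
  rw [partSeq]
  congr 1
  ext
  simp [i.2.le]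

lemma partSeq_succ (D : Partition) (i : Fin D.n) : partSeq D (i + 1) = D.pt i.succ := by
  rw [partSeq]
  congr 1
  ext
  simp

lemma partSeq_of_le (D : Partition) {i : ℕ} (h : D.n ≤ i) : partSeq D i = 1 := by
  rw [partSeq, ← D.pt_last]
  congr 1
  ext
  simp [h]

lemma tagSeq_val (D : Partition) (ξ : Fin D.n → I) (i : Fin D.n) : tagSeq D ξ i = ξ i := by
  simp [tagSeq]

lemma isTaggedGrid_partSeq {δ : ℝ} (hδ : 0 < δ) {D : Partition} (hD : D.MeshLT δ)
    {ξ : Fin D.n → I} (hξ : D.IsTag ξ) : IsTaggedGrid δ D.n (partSeq D) (tagSeq D ξ) where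
  zero := by
    rw [← D.pt_zero, partSeq]
    congr 1
  last := partSeq_of_le D le_rfl
  mono := fun i j h => D.strictMono.monotone (by rw [Fin.le_def]; simp only; omega)
  tag := by
    intro i
    by_cases h : i < D.n
    · have := hξ ⟨i, h⟩
      rw [← partSeq_castSucc, ← partSeq_succ] at this
      simpa [tagSeq, h] using this
    · rw [partSeq_of_le D (by omega), partSeq_of_le D (by omega), tagSeq, dif_neg h]
      simp
  mesh := by
    intro i
    by_cases h : i < D.n
    · have := hD ⟨i, h⟩
      rwa [← partSeq_castSucc, ← partSeq_succ] at this
    · rw [partSeq_of_le D (by omega), partSeq_of_le D (by omega), sub_self]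
      exact hδ

lemma hasRSIntegral_of_forall_grid {f g : I → I → ℝ} {c : ℝ}
    (h : ∀ ε > 0, ∃ δ > 0, ∀ (n m : ℕ) (s a t b : ℕ → I), IsTaggedGrid δ n s a →
      IsTaggedGrid δ m t b → |∑ i ∈ Finset.range n, ∑ j ∈ Finset.range m,
        f (a i) (b j) * rect g (s i) (s (i + 1)) (t j) (t (j + 1)) - c| < ε) :
    HasRSIntegral f g c := by
  intro ε hε
  obtain ⟨δ, hδ, h⟩ := h ε hε
  refine ⟨δ, hδ, fun D D' hD hD' ξ η hξ hη => ?_⟩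
  have := h _ _ _ _ _ _ (isTaggedGrid_partSeq hδ hD hξ) (isTaggedGrid_partSeq hδ hD' hη)
  simpa only [Finset.sum_range, partSeq_castSucc, partSeq_succ, tagSeq_val,
    Partition.cell] using this

lemma isTaggedGrid_dyPt_left {δ : ℝ} {n : ℕ} (h : (1 / 2 : ℝ) ^ n < δ) :
    IsTaggedGrid δ (2 ^ n) (dyPt n) (dyPt n) where
  zero := dyPt_zero n
  last := dyPt_last n
  mono := monotone_dyPt n
  tag := fun i => ⟨le_rfl, monotone_dyPt n (Nat.le_succ i)⟩
  mesh := by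
    intro i
    refine lt_of_le_of_lt ?_ h
    simp only [dyPt]
    have e : ((i + 1 : ℕ) : ℝ) / 2 ^ n = (i : ℝ) / 2 ^ n + (1 / 2) ^ n := by
      rw [one_div, inv_pow, ← one_div]
      push_cast
      ring
    have h0 : (0 : ℝ) < (1 / 2) ^ n := by positivity
    rw [e]
    rcases le_total ((i : ℝ) / 2 ^ n) 1 with h1 | h1
    · rw [min_eq_left h1]
      linarith [min_le_left ((i : ℝ) / 2 ^ n + (1 / 2) ^ n) 1]
    · rw [min_eq_right h1]
      linarith [min_le_right ((i : ℝ) / 2 ^ n + (1 / 2) ^ n) 1]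

lemma isTaggedGrid_dyPt_right {δ : ℝ} {n : ℕ} (h : (1 / 2 : ℝ) ^ n < δ) :
    IsTaggedGrid δ (2 ^ n) (dyPt n) (fun i => dyPt n (i + 1)) :=
  { isTaggedGrid_dyPt_left h with
    tag := fun i => ⟨monotone_dyPt n (Nat.le_succ i), le_rfl⟩ }

/-! ### Riemann–Stieltjes sums of step functions -/

lemma IsTaggedGrid.sum_sub {δ : ℝ} {n : ℕ} {s a : ℕ → I} (h : IsTaggedGrid δ n s a) (y : I → ℝ) :
    ∑ i ∈ Finset.range n, (y (s (i + 1)) - y (s i)) = y 1 - y 0 := by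
  rw [Finset.sum_range_sub (fun i => y (s i)), h.zero, h.last]

/-- The Riemann–Stieltjes sums of the indicator of an initial interval telescope. The statement
holds for both initial intervals `[0, c)` and `[0, c]`. -/
lemma IsTaggedGrid.exists_sum_initial {δ : ℝ} {n : ℕ} {s a : ℕ → I} (h : IsTaggedGrid δ n s a)
    (A : Set I) (c : I) (hA : ∀ x < c, x ∈ A) (hA' : ∀ x, c < x → x ∉ A) :
    ∃ c' : I, |(c' : ℝ) - c| ≤ δ ∧ ∀ y : I → ℝ,
      ∑ i ∈ Finset.range n, A.indicator 1 (a i) * (y (s (i + 1)) - y (s i)) = y c' - y 0 := by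
  classical
  have hex : ∃ k, k = n ∨ a k ∉ A := ⟨n, Or.inl rfl⟩
  set k := Nat.find hex with hk
  have hkn : k ≤ n := Nat.find_min' hex (Or.inl rfl)
  have hlt : ∀ i < k, a i ∈ A := by
    intro i hi
    have := Nat.find_min hex hi
    push Not at this
    exact this.2
  have hge : ∀ i, k ≤ i → i < n → a i ∉ A := by
    intro i hki hin hi
    rcases Nat.find_spec hex with h1 | h1
    · omega
    · -- the set `A` is an initial interval
      have h2 : a k ≤ a i := h.mono_tag hki
      have h3 : c ≤ a k := not_lt.1 fun h4 => h1 (hA _ h4)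
      have h5 : a i ≤ c := not_lt.1 fun h4 => hA' _ h4 hi
      have h6 : a k = a i := le_antisymm h2 (h5.trans h3)
      exact h1 (by rw [← hk, h6]; exact hi)
  refine ⟨s k, ?_, fun y => ?_⟩
  · rw [abs_le]
    constructor
    · -- the next point of the grid is not below `c`
      have h1 : (c : ℝ) ≤ s (k + 1) := by
        rcases Nat.find_spec hex with h1 | h1
        · have h2 : s n ≤ s (k + 1) := h.mono (by omega)
          rw [h.last] at h2
          exact_mod_cast c.2.2.trans h2
        · exact_mod_cast (not_lt.1 fun h4 => h1 (hA _ h4) : c ≤ a k).trans (h.tag k).2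
      linarith [h.mesh k]
    · rcases Nat.eq_zero_or_pos k with h0 | h0
      · rw [h0, h.zero]
        have h1 := h.mesh 0
        have h2 : (s 0 : ℝ) ≤ s 1 := h.mono (Nat.zero_le 1)
        have := c.2.1
        simp only [zero_add] at h1
        simp only [Set.Icc.coe_zero]
        linarith
      · -- the previous point of the grid is not above `c`
        obtain ⟨l, hl⟩ : ∃ l, k = l + 1 := ⟨k - 1, by omega⟩
        have h1 : a l ≤ c := not_lt.1 fun h4 => hA' _ h4 (hlt l (by omega))
        have h2 : (s l : ℝ) ≤ c := (h.tag l).1.trans h1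
        have h3 := h.mesh l
        rw [hl]
        linarith
  · obtain ⟨m, hm⟩ := Nat.exists_eq_add_of_le hkn
    have e1 : ∀ i ∈ Finset.range k, A.indicator (1 : I → ℝ) (a i) * (y (s (i + 1)) - y (s i)) =
        y (s (i + 1)) - y (s i) := by
      intro i hi
      rw [Set.indicator_of_mem (hlt i (Finset.mem_range.1 hi)), Pi.one_apply, one_mul]
    have e2 : ∀ i ∈ Finset.range m, A.indicator (1 : I → ℝ) (a (k + i)) *
        (y (s (k + i + 1)) - y (s (k + i))) = 0 := by
      intro i hi
      have := Finset.mem_range.1 hi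
      rw [Set.indicator_of_notMem (hge _ (by omega) (by omega)), zero_mul]
    rw [hm, Finset.sum_range_add, Finset.sum_congr rfl e1, Finset.sum_congr rfl e2,
      Finset.sum_const_zero, add_zero, Finset.sum_range_sub (fun i => y (s i)), h.zero]

lemma IsTaggedGrid.exists_sum_ioc {δ : ℝ} {n : ℕ} {s a : ℕ → I} (h : IsTaggedGrid δ n s a)
    (d : I) : ∃ c' d' : I, |(c' : ℝ)| ≤ δ ∧ |(d' : ℝ) - d| ≤ δ ∧ ∀ y : I → ℝ,
      ∑ i ∈ Finset.range n, ioc 0 d (a i) * (y (s (i + 1)) - y (s i)) = y d' - y c' := by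
  obtain ⟨c', hc', e1⟩ := h.exists_sum_initial (Set.Iic 0) 0 (fun x hx => hx.le)
    (fun x hx => not_le.2 hx)
  obtain ⟨d', hd', e2⟩ := h.exists_sum_initial (Set.Iic d) d (fun x hx => hx.le)
    (fun x hx => not_le.2 hx)
  refine ⟨c', d', by simpa using hc', hd', fun y => ?_⟩
  have e3 : ∀ x : I, ioc 0 d x = (Set.Iic d).indicator 1 x - (Set.Iic 0).indicator 1 x := by
    intro x
    have h1 : (0 : I) ≤ d := unitInterval.nonneg'
    simp only [ioc, Set.indicator_apply, Set.mem_Ioc, Set.mem_Iic, Pi.one_apply]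
    split_ifs <;> grind
  simp only [e3, sub_mul, Finset.sum_sub_distrib, e1, e2]
  ring

lemma levyKernel_zero_one (x u : I) : levyKernel 0 1 x u =
    1 / 2 * ((Set.Iio u).indicator 1 x + (Set.Iic u).indicator 1 x - 1) := by
  simp only [levyKernel, areaKernel, Set.indicator_apply, Set.mem_ofPred_eq, Set.mem_Iio,
    Set.mem_Iic, Pi.one_apply]
  rcases lt_trichotomy x u with h | h | h
  · simp [h, h.le, not_lt.2 h.le]
  · simp [h]
  · simp [h, not_lt.2 h.le, not_le.2 h]

lemma levyKernel_one_zero (x u : I) : levyKernel 1 0 x u = -levyKernel 0 1 x u := by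
  simp only [levyKernel, areaKernel]
  norm_num
  ring

lemma levyKernel_same (i : Fin 2) (x u : I) : levyKernel i i x u = 0 := by
  simp [levyKernel, areaKernel]

lemma IsTaggedGrid.exists_sum_levyKernel {δ : ℝ} {n : ℕ} {s a : ℕ → I}
    (h : IsTaggedGrid δ n s a) (u : I) : ∃ u' u'' : I, |(u' : ℝ) - u| ≤ δ ∧ |(u'' : ℝ) - u| ≤ δ ∧
      ∀ y : I → ℝ, ∑ i ∈ Finset.range n, levyKernel 0 1 (a i) u * (y (s (i + 1)) - y (s i)) =
        1 / 2 * (y u' + y u'' - y 0 - y 1) := by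
  obtain ⟨u', hu', e1⟩ := h.exists_sum_initial (Set.Iio u) u (fun x hx => hx)
    (fun x hx => not_lt.2 hx.le)
  obtain ⟨u'', hu'', e2⟩ := h.exists_sum_initial (Set.Iic u) u (fun x hx => hx.le)
    (fun x hx => not_le.2 hx)
  refine ⟨u', u'', hu', hu'', fun y => ?_⟩
  have e : ∀ i, levyKernel 0 1 (a i) u * (y (s (i + 1)) - y (s i)) =
      1 / 2 * ((Set.Iio u).indicator 1 (a i) * (y (s (i + 1)) - y (s i)) +
        (Set.Iic u).indicator 1 (a i) * (y (s (i + 1)) - y (s i)) - (y (s (i + 1)) - y (s i))) := by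
    intro i
    rw [levyKernel_zero_one]
    ring
  simp only [e]
  rw [← Finset.mul_sum, Finset.sum_sub_distrib, Finset.sum_add_distrib, e1, e2, h.sum_sub]
  ring

lemma exists_forall_abs_sub_le {r : I → I → ℝ} (hr : Continuous fun z : I × I => r z.1 z.2) {ε : ℝ}
    (hε : 0 < ε) : ∃ δ > 0, ∀ x x' y y' : I, |(x : ℝ) - x'| ≤ δ → |(y : ℝ) - y'| ≤ δ →
      |r x y - r x' y'| ≤ ε := by
  obtain ⟨δ, hδ, hu⟩ := Metric.uniformContinuous_iff.1
    (CompactSpace.uniformContinuous_of_continuous hr) ε hε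
  refine ⟨δ / 2, by positivity, fun x x' y y' hx hy => ?_⟩
  have := hu (a := (x, y)) (b := (x', y')) (by
    rw [Prod.dist_eq]
    refine max_lt ?_ ?_ <;> rw [Subtype.dist_eq, Real.dist_eq] <;> linarith)
  rw [Real.dist_eq] at this
  exact this.le

/-- The inner integral of the Lévy kernel against an indicator. -/
lemma hasRSIntegral_levyKernel_mul_ioc {r : I → I → ℝ}
    (hr : Continuous fun z : I × I => r z.1 z.2) (b u : I) :
    HasRSIntegral (fun s t => levyKernel 0 1 s u * ioc 0 b t) r
      (rect r 0 u 0 b - 1 / 2 * rect r 0 1 0 b) := by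
  refine hasRSIntegral_of_forall_grid fun ε hε => ?_
  obtain ⟨δ, hδ, hu⟩ := exists_forall_abs_sub_le hr (ε := ε / 5) (by positivity)
  refine ⟨δ, hδ, fun n m s a t b' hs ht => ?_⟩
  obtain ⟨u', u'', hu', hu'', e1⟩ := hs.exists_sum_levyKernel u
  obtain ⟨c', d', hc', hd', e2⟩ := ht.exists_sum_ioc b
  have e3 : ∑ i ∈ Finset.range n, ∑ j ∈ Finset.range m, levyKernel 0 1 (a i) u * ioc 0 b (b' j) *
      rect r (s i) (s (i + 1)) (t j) (t (j + 1)) =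
      1 / 2 * ((r u' d' - r u' c') + (r u'' d' - r u'' c') - (r 0 d' - r 0 c') -
        (r 1 d' - r 1 c')) := by
    rw [← e1 (fun x => r x d' - r x c')]
    refine Finset.sum_congr rfl fun i _ => ?_
    rw [← e2 (r (s (i + 1))), ← e2 (r (s i)), ← Finset.sum_sub_distrib, Finset.mul_sum]
    refine Finset.sum_congr rfl fun j _ => ?_
    simp only [rect]
    ring
  rw [e3]
  have hc0 : |(c' : ℝ) - (0 : I)| ≤ δ := by simpa using hc'
  have h1 := abs_le.1 (hu u' u d' b hu' hd')
  have h2 := abs_le.1 (hu u' u c' 0 hu' hc0)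
  have h3 := abs_le.1 (hu u'' u d' b hu'' hd')
  have h4 := abs_le.1 (hu u'' u c' 0 hu'' hc0)
  have h5 := abs_le.1 (hu 0 0 d' b (by simpa using hδ.le) hd')
  have h6 := abs_le.1 (hu 0 0 c' 0 (by simpa using hδ.le) hc0)
  have h7 := abs_le.1 (hu 1 1 d' b (by simpa using hδ.le) hd')
  have h8 := abs_le.1 (hu 1 1 c' 0 (by simpa using hδ.le) hc0)
  simp only [rect]
  rw [abs_lt]
  constructor <;> linarith

/-! ### The Young integral in the outer variable -/

/-- A function of the rounded argument as a linear combination of indicators. -/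
lemma comp_roundDown_eq_sum (g : I → ℝ) (N : ℕ) (x : I) :
    g (roundDown N x) = g 0 + ∑ k ∈ Finset.range (2 ^ N), (g (dyPt N (k + 1)) - g (dyPt N k)) *
      (1 - (Set.Iio (dyPt N (k + 1))).indicator 1 x) := by
  have h0 : (0 : ℝ) < 2 ^ N := by positivity
  set K := ⌊(2 : ℝ) ^ N * x⌋₊ with hK
  have hx0 : 0 ≤ (2 : ℝ) ^ N * x := mul_nonneg h0.le x.2.1
  have hKN : K ≤ 2 ^ N := by
    have h1 : (K : ℝ) ≤ 2 ^ N * x := Nat.floor_le hx0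
    have h2 : (2 : ℝ) ^ N * x ≤ 2 ^ N := mul_le_of_le_one_right h0.le x.2.2
    exact_mod_cast h1.trans h2
  have hround : roundDown N x = dyPt N K := Subtype.ext (by rw [coe_dyPt hKN]; rfl)
  obtain ⟨m, hm⟩ := Nat.exists_eq_add_of_le hKN
  have hmem : ∀ k < 2 ^ N, x < dyPt N (k + 1) ↔ K ≤ k := by
    intro k hk
    rw [← Subtype.coe_lt_coe, coe_dyPt hk, lt_div_iff₀ h0, mul_comm, ← Nat.floor_lt hx0,
      Nat.lt_succ_iff]
  have e1 : ∀ k ∈ Finset.range K, (g (dyPt N (k + 1)) - g (dyPt N k)) *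
      (1 - (Set.Iio (dyPt N (k + 1))).indicator 1 x) = g (dyPt N (k + 1)) - g (dyPt N k) := by
    intro k hk
    have hk' := Finset.mem_range.1 hk
    have : x ∉ Set.Iio (dyPt N (k + 1)) := by
      rw [Set.mem_Iio, hmem k (by omega)]
      omega
    rw [Set.indicator_of_notMem this, sub_zero, mul_one]
  have e2 : ∀ k ∈ Finset.range m, (g (dyPt N (K + k + 1)) - g (dyPt N (K + k))) *
      (1 - (Set.Iio (dyPt N (K + k + 1))).indicator 1 x) = 0 := by
    intro k hk
    have hk' := Finset.mem_range.1 hk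
    have : x ∈ Set.Iio (dyPt N (K + k + 1)) := by
      rw [Set.mem_Iio, hmem _ (by omega)]
      omega
    rw [Set.indicator_of_mem this, Pi.one_apply, sub_self, mul_zero]
  rw [hround, hm, Finset.sum_range_add, Finset.sum_congr rfl e1, Finset.sum_congr rfl e2,
    Finset.sum_const_zero, add_zero, Finset.sum_range_sub (fun k => g (dyPt N k)), dyPt_zero]
  ring

/-- The Riemann–Stieltjes sum of `x ↦ rect r₀ 0 x 0 b` against `x ↦ rect r₁ 0 x 0 d`. -/
noncomputable def lineSum (r₀ r₁ : I → I → ℝ) (b d : I) (n : ℕ) (s a : ℕ → I) : ℝ :=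
  ∑ i ∈ Finset.range n, rect r₀ 0 (a i) 0 b * rect r₁ (s i) (s (i + 1)) 0 d

lemma lineSum_eq_tagSum (r₀ r₁ : I → I → ℝ) (b d : I) (n : ℕ) (s a : ℕ → I) :
    lineSum r₀ r₁ b d n s a =
      tagSum r₀ r₁ n 1 a (fun _ => b) s (fun j => if j = 0 then 0 else d) := by
  simp [lineSum, tagSum]

/-- The sums `lineSum` have a limit as the mesh tends to zero, and this limit depends continuously
on the end point `d`. -/
lemma exists_abs_lineSum_sub_le {p q : ℝ} (hp : 1 ≤ p) (hq : 1 ≤ q) (hpq : 1 < p⁻¹ + q⁻¹)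
    {r₀ r₁ : I → I → ℝ} (hr₀ : Continuous fun z : I × I => r₀ z.1 z.2)
    (hr₁ : Continuous fun z : I × I => r₁ z.1 z.2) {K L : ℝ} (hK : 0 < K) (hL : 0 < L)
    (h₀ : VarLE r₀ p K) (h₁ : VarLE r₁ q L) (b : I) {ε : ℝ} (hε : 0 < ε) :
    ∃ δ > 0, ∀ (n n' : ℕ) (s a s' a' : ℕ → I), IsTaggedGrid δ n s a → IsTaggedGrid δ n' s' a' →
      ∀ d d' : I, |(d : ℝ) - d'| ≤ δ →
        |lineSum r₀ r₁ b d n s a - lineSum r₀ r₁ b d' n' s' a'| ≤ ε := by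
  obtain ⟨N, hN⟩ := exists_abs_tagSum_sub_le hp hq hpq hr₀ hr₁ hK hL h₀ h₁
    (ε := ε / 3) (by positivity)
  -- the integrand rounded to level `N` is a step function
  set g : I → ℝ := fun x => rect r₀ 0 x 0 (roundDown N b) with hg
  have hg0 : g 0 = 0 := by simp [hg, rect]
  set B : ℝ := ∑ k ∈ Finset.range (2 ^ N), |g (dyPt N (k + 1)) - g (dyPt N k)| with hB
  have hB0 : 0 ≤ B := Finset.sum_nonneg fun _ _ => abs_nonneg _
  obtain ⟨δ, hδ, hu⟩ := exists_forall_abs_sub_le hr₁ (ε := ε / 3 / (4 * (B + 1))) (by positivity)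
  set ω : ℝ := ε / 3 / (4 * (B + 1)) with hω
  have hωB : B * (4 * ω) ≤ ε / 3 := by
    rw [hω, show B * (4 * (ε / 3 / (4 * (B + 1)))) = B * (ε / 3) / (B + 1) by field_simp,
      div_le_iff₀ (by positivity)]
    nlinarith
  have hround : ∀ {n : ℕ} {s a : ℕ → I}, IsTaggedGrid (δ / 2) n s a → ∀ d : I,
      |lineSum r₀ r₁ b d n s a - lineSum (roundKernel N r₀) r₁ b d n s a| ≤ ε / 3 := by
    intro n s a h d
    rw [lineSum_eq_tagSum, lineSum_eq_tagSum]
    refine (hN N le_rfl n 1 a (fun _ => b) s _ h.mono_tag monotone_const h.mono ?_).1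
    intro i j hij
    dsimp only
    split_ifs
    · exact le_rfl
    · exact unitInterval.nonneg'
    · omega
    · exact le_rfl
  have hstep : ∀ {n : ℕ} {s a : ℕ → I}, IsTaggedGrid (δ / 2) n s a → ∃ c : ℕ → I,
      (∀ k, |(c k : ℝ) - dyPt N (k + 1)| ≤ δ / 2) ∧ ∀ d : I,
      lineSum (roundKernel N r₀) r₁ b d n s a = ∑ k ∈ Finset.range (2 ^ N),
        (g (dyPt N (k + 1)) - g (dyPt N k)) * rect r₁ (c k) 1 0 d := by
    intro n s a h
    choose c hc hce using fun k => h.exists_sum_initial (Set.Iio (dyPt N (k + 1)))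
      (dyPt N (k + 1)) (fun x hx => hx) (fun x hx => not_lt.2 hx.le)
    refine ⟨c, hc, fun d => ?_⟩
    have e1 : ∀ i, rect (roundKernel N r₀) 0 (a i) 0 b = g (roundDown N (a i)) := by
      intro i
      simp only [rect, roundKernel, roundDown_zero, hg]
    simp only [lineSum, e1, comp_roundDown_eq_sum g N, hg0, zero_add, Finset.sum_mul]
    rw [Finset.sum_comm]
    refine Finset.sum_congr rfl fun k _ => ?_
    have e2 := hce k (fun x => r₁ x d - r₁ x 0)
    have e3 := h.sum_sub (fun x => r₁ x d - r₁ x 0)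
    have e4 : rect r₁ (c k) 1 0 d = (r₁ 1 d - r₁ 1 0 - (r₁ 0 d - r₁ 0 0)) -
        (r₁ (c k) d - r₁ (c k) 0 - (r₁ 0 d - r₁ 0 0)) := by
      simp only [rect]
      ring
    rw [e4, ← e2, ← e3, ← Finset.sum_sub_distrib, Finset.mul_sum]
    refine Finset.sum_congr rfl fun i _ => ?_
    simp only [rect]
    ring
  refine ⟨δ / 2, by positivity, fun n n' s a s' a' h h' d d' hd => ?_⟩
  obtain ⟨c, hc, hce⟩ := hstep h
  obtain ⟨c', hc', hce'⟩ := hstep h'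
  have key : |lineSum (roundKernel N r₀) r₁ b d n s a -
      lineSum (roundKernel N r₀) r₁ b d' n' s' a'| ≤ ε / 3 := by
    rw [hce, hce', ← Finset.sum_sub_distrib]
    refine le_trans ?_ hωB
    rw [hB, Finset.sum_mul]
    refine (Finset.abs_sum_le_sum_abs _ _).trans (Finset.sum_le_sum fun k _ => ?_)
    rw [← mul_sub, abs_mul]
    gcongr
    have hcc : |(c k : ℝ) - c' k| ≤ δ := by
      have h1 := abs_le.1 (hc k)
      have h2 := abs_le.1 (hc' k)
      rw [abs_le]
      constructor <;> linarith
    have hd' : |(d : ℝ) - d'| ≤ δ := by linarith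
    have h1 := abs_le.1 (hu 1 1 d d' (by simpa using hδ.le) hd')
    have h3 := abs_le.1 (hu (c k) (c' k) d d' hcc hd')
    have h4 := abs_le.1 (hu (c k) (c' k) 0 0 hcc (by simpa using hδ.le))
    simp only [rect]
    rw [abs_le]
    constructor <;> linarith
  have h1 := abs_le.1 (hround h d)
  have h2 := abs_le.1 (hround h' d')
  have h3 := abs_le.1 key
  rw [abs_le]
  constructor <;> linarith

lemma lineSum_self (r₀ r₁ : I → I → ℝ) (b : I) (n : ℕ) (s a : ℕ → I) :
    lineSum r₀ r₁ b 0 n s a = 0 := by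
  simp [lineSum, rect]

lemma levyForm_eq_lineSum (r₀ r₁ : I → I → ℝ) (b d : I) (n : ℕ) :
    levyForm n (fun x => r₀ x b - r₀ x 0) (fun x => r₁ x d - r₁ x 0) =
      1 / 2 * (lineSum r₀ r₁ b d (2 ^ n) (dyPt n) (dyPt n) +
        lineSum r₀ r₁ b d (2 ^ n) (dyPt n) (fun l => dyPt n (l + 1)) -
        rect r₀ 0 1 0 b * rect r₁ 0 1 0 d) := by
  have e : rect r₁ 0 1 0 d = ∑ i ∈ Finset.range (2 ^ n),
      rect r₁ (dyPt n i) (dyPt n (i + 1)) 0 d := by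
    have := Finset.sum_range_sub (fun i => r₁ (dyPt n i) d - r₁ (dyPt n i) 0) (2 ^ n)
    simp only [dyPt_zero, dyPt_last] at this
    simp only [rect]
    rw [show r₁ 1 d - r₁ 1 0 - r₁ 0 d + r₁ 0 0 = r₁ 1 d - r₁ 1 0 - (r₁ 0 d - r₁ 0 0) by ring,
      ← this]
    exact Finset.sum_congr rfl fun i _ => by ring
  rw [levyForm_eq, e, lineSum, lineSum, Finset.mul_sum, ← Finset.sum_add_distrib,
    ← Finset.sum_sub_distrib, Finset.mul_sum]
  refine Finset.sum_congr rfl fun l _ => ?_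
  simp only [rect]
  ring

/-- The iterated integral of the Lévy kernel against a product of indicators exists, and it is the
limit of the dyadic Lévy forms. -/
lemma hasIteratedRSIntegral_levyKernel_mul_ioc {p q : ℝ} (hp : 1 ≤ p) (hq : 1 ≤ q)
    (hpq : 1 < p⁻¹ + q⁻¹) {r₀ r₁ : I → I → ℝ} (hr₀ : Continuous fun z : I × I => r₀ z.1 z.2)
    (hr₁ : Continuous fun z : I × I => r₁ z.1 z.2) {K L : ℝ} (hK : 0 < K) (hL : 0 < L)
    (h₀ : VarLE r₀ p K) (h₁ : VarLE r₁ q L) (b d : I) {c : ℝ}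
    (hc : Tendsto (fun n => levyForm n (fun x => r₀ x b - r₀ x 0) (fun x => r₁ x d - r₁ x 0))
      atTop (𝓝 c)) :
    HasIteratedRSIntegral (fun s t u v => levyKernel 0 1 s u * (ioc 0 b t * ioc 0 d v)) r₀ r₁
      c := by
  refine ⟨fun u v => ioc 0 d v * (rect r₀ 0 u 0 b - 1 / 2 * rect r₀ 0 1 0 b), fun u v => ?_, ?_⟩
  · intro ε hε
    have hioc : |ioc 0 d v| ≤ 1 := by
      rw [ioc, Set.indicator_apply]
      split_ifs <;> simp
    obtain ⟨δ, hδ, h⟩ := hasRSIntegral_levyKernel_mul_ioc hr₀ b u ε hε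
    refine ⟨δ, hδ, fun D D' hD hD' ξ η hξ hη => ?_⟩
    refine lt_of_le_of_lt ?_ (h D D' hD hD' ξ η hξ hη)
    calc _ = |ioc 0 d v| * |∑ i : Fin D.n, ∑ j : Fin D'.n,
          levyKernel 0 1 (ξ i) u * ioc 0 b (η j) * D.cell D' r₀ i j -
            (rect r₀ 0 u 0 b - 1 / 2 * rect r₀ 0 1 0 b)| := by
          rw [← abs_mul, mul_sub, Finset.mul_sum]
          congr 2
          refine Finset.sum_congr rfl fun i _ => ?_
          rw [Finset.mul_sum]
          exact Finset.sum_congr rfl fun j _ => by ring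
      _ ≤ _ := mul_le_of_le_one_left (abs_nonneg _) hioc
  refine hasRSIntegral_of_forall_grid fun ε hε => ?_
  set B : ℝ := |rect r₀ 0 1 0 b| with hB
  have hB0 : 0 ≤ B := abs_nonneg _
  obtain ⟨δ, hδ, hline⟩ := exists_abs_lineSum_sub_le hp hq hpq hr₀ hr₁ hK hL h₀ h₁ b
    (ε := ε / 8) (by positivity)
  set ω : ℝ := ε / 8 / (B + 1) with hω
  have hω0 : 0 < ω := by positivity
  have hωB : B * ω ≤ ε / 8 := by
    rw [hω, mul_div_assoc', div_le_iff₀ (by positivity)]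
    nlinarith
  obtain ⟨δ', hδ', hu⟩ := exists_forall_abs_sub_le hr₁ hω0
  refine ⟨min δ δ', by positivity, fun n m s a t b' hs ht => ?_⟩
  have hs' : IsTaggedGrid δ n s a :=
    { hs with mesh := fun i => (hs.mesh i).trans_le (min_le_left _ _) }
  obtain ⟨c', d', hc', hd', e2⟩ := ht.exists_sum_ioc d
  -- compare with the Lévy form of a level `N` which is fine enough
  obtain ⟨N, hN1, hN2⟩ : ∃ N : ℕ, (1 / 2 : ℝ) ^ N < δ ∧
      |levyForm N (fun x => r₀ x b - r₀ x 0) (fun x => r₁ x d - r₁ x 0) - c| < ε / 8 := by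
    have h1 := (tendsto_pow_atTop_nhds_zero_of_lt_one (by norm_num : (0 : ℝ) ≤ 1 / 2)
      (by norm_num)).eventually (gt_mem_nhds hδ)
    have h2 := hc.eventually (Metric.ball_mem_nhds c (by positivity : 0 < ε / 8))
    obtain ⟨N, h3, h4⟩ := (h1.and h2).exists
    exact ⟨N, h3, by simpa [Real.dist_eq] using h4⟩
  rw [levyForm_eq_lineSum] at hN2
  have e3 : ∑ i ∈ Finset.range n, ∑ j ∈ Finset.range m,
      ioc 0 d (b' j) * (rect r₀ 0 (a i) 0 b - 1 / 2 * rect r₀ 0 1 0 b) *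
        rect r₁ (s i) (s (i + 1)) (t j) (t (j + 1)) =
      lineSum r₀ r₁ b d' n s a - lineSum r₀ r₁ b c' n s a -
        1 / 2 * (rect r₀ 0 1 0 b * rect r₁ 0 1 c' d') := by
    have e4 : rect r₁ 0 1 c' d' = ∑ i ∈ Finset.range n, rect r₁ (s i) (s (i + 1)) c' d' := by
      have := hs.sum_sub (fun x => r₁ x d' - r₁ x c')
      simp only [rect]
      rw [show r₁ 1 d' - r₁ 1 c' - r₁ 0 d' + r₁ 0 c' = r₁ 1 d' - r₁ 1 c' - (r₁ 0 d' - r₁ 0 c') by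
        ring, ← this]
      exact Finset.sum_congr rfl fun i _ => by ring
    rw [e4, lineSum, lineSum, ← Finset.sum_sub_distrib, Finset.mul_sum, Finset.mul_sum,
      ← Finset.sum_sub_distrib]
    refine Finset.sum_congr rfl fun i _ => ?_
    have e5 : rect r₁ (s i) (s (i + 1)) c' d' =
        ∑ j ∈ Finset.range m, ioc 0 d (b' j) * rect r₁ (s i) (s (i + 1)) (t j) (t (j + 1)) := by
      have := e2 (fun y => r₁ (s (i + 1)) y - r₁ (s i) y)
      simp only [rect]
      rw [show r₁ (s (i + 1)) d' - r₁ (s (i + 1)) c' - r₁ (s i) d' + r₁ (s i) c' =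
        r₁ (s (i + 1)) d' - r₁ (s i) d' - (r₁ (s (i + 1)) c' - r₁ (s i) c') by ring, ← this]
      exact Finset.sum_congr rfl fun j _ => by ring
    have e6 : ∑ j ∈ Finset.range m, ioc 0 d (b' j) *
        (rect r₀ 0 (a i) 0 b - 1 / 2 * rect r₀ 0 1 0 b) *
          rect r₁ (s i) (s (i + 1)) (t j) (t (j + 1)) =
        (rect r₀ 0 (a i) 0 b - 1 / 2 * rect r₀ 0 1 0 b) * rect r₁ (s i) (s (i + 1)) c' d' := by
      rw [e5, Finset.mul_sum]
      exact Finset.sum_congr rfl fun j _ => by ring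
    rw [e6]
    simp only [rect]
    ring
  rw [e3]
  have hc0 : |(c' : ℝ) - (0 : I)| ≤ min δ δ' := by simpa using hc'
  have h1 := abs_le.1 (hline n (2 ^ N) s a _ _ hs' (isTaggedGrid_dyPt_left hN1) d' d
    (hd'.trans (min_le_left _ _)))
  have h2 := abs_le.1 (hline n (2 ^ N) s a _ _ hs' (isTaggedGrid_dyPt_right hN1) d' d
    (hd'.trans (min_le_left _ _)))
  have h3 := abs_le.1 (hline n n s a s a hs' hs' c' 0 (hc0.trans (min_le_left _ _)))
  rw [lineSum_self, sub_zero] at h3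
  have h4 : |rect r₀ 0 1 0 b * rect r₁ 0 1 c' d' - rect r₀ 0 1 0 b * rect r₁ 0 1 0 d| ≤
      ε / 2 := by
    rw [← mul_sub, abs_mul, ← hB]
    have h5 : |rect r₁ 0 1 c' d' - rect r₁ 0 1 0 d| ≤ 4 * ω := by
      have hd0 := hd'.trans (min_le_right δ δ')
      have hc1 := hc0.trans (min_le_right δ δ')
      have g1 := abs_le.1 (hu 1 1 d' d (by simpa using hδ'.le) hd0)
      have g2 := abs_le.1 (hu 0 0 d' d (by simpa using hδ'.le) hd0)
      have g3 := abs_le.1 (hu 1 1 c' 0 (by simpa using hδ'.le) hc1)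
      have g4 := abs_le.1 (hu 0 0 c' 0 (by simpa using hδ'.le) hc1)
      simp only [rect]
      rw [abs_le]
      constructor <;> linarith
    calc _ ≤ B * (4 * ω) := by gcongr
      _ ≤ _ := by linarith
  have h5 := abs_le.1 h4
  have h6 := abs_lt.1 hN2
  rw [abs_lt]
  constructor <;> linarith

/-! ### Linearity of the integrals and general step functions -/

lemma hasRSIntegral_zero (g : I → I → ℝ) : HasRSIntegral (fun _ _ => 0) g 0 := by
  intro ε hε
  exact ⟨1, one_pos, fun D D' _ _ ξ η _ _ => by simpa using hε⟩

lemma HasRSIntegral.add {f f' g : I → I → ℝ} {c c' : ℝ} (h : HasRSIntegral f g c)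
    (h' : HasRSIntegral f' g c') : HasRSIntegral (fun s t => f s t + f' s t) g (c + c') := by
  intro ε hε
  obtain ⟨δ, hδ, h1⟩ := h (ε / 2) (by positivity)
  obtain ⟨δ', hδ', h2⟩ := h' (ε / 2) (by positivity)
  refine ⟨min δ δ', by positivity, fun D D' hD hD' ξ η hξ hη => ?_⟩
  have h3 := abs_lt.1 (h1 D D' (fun i => (hD i).trans_le (min_le_left _ _))
    (fun i => (hD' i).trans_le (min_le_left _ _)) ξ η hξ hη)
  have h4 := abs_lt.1 (h2 D D' (fun i => (hD i).trans_le (min_le_right _ _))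
    (fun i => (hD' i).trans_le (min_le_right _ _)) ξ η hξ hη)
  simp only [add_mul, Finset.sum_add_distrib]
  rw [abs_lt]
  constructor <;> linarith

lemma HasRSIntegral.const_mul {f g : I → I → ℝ} {c : ℝ} (h : HasRSIntegral f g c) (x : ℝ) :
    HasRSIntegral (fun s t => x * f s t) g (x * c) := by
  intro ε hε
  obtain ⟨δ, hδ, h1⟩ := h (ε / (|x| + 1)) (by positivity)
  refine ⟨δ, hδ, fun D D' hD hD' ξ η hξ hη => ?_⟩
  have h2 := h1 D D' hD hD' ξ η hξ hη
  simp only [mul_assoc, ← Finset.mul_sum]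
  rw [← mul_sub, abs_mul]
  rw [lt_div_iff₀ (by positivity)] at h2
  refine lt_of_le_of_lt ?_ h2
  rw [mul_comm]
  gcongr
  linarith

lemma hasIteratedRSIntegral_zero (R R' : I → I → ℝ) :
    HasIteratedRSIntegral (fun _ _ _ _ => 0) R R' 0 :=
  ⟨fun _ _ => 0, fun _ _ => hasRSIntegral_zero _, hasRSIntegral_zero _⟩

lemma HasIteratedRSIntegral.add {k k' : I → I → I → I → ℝ} {R R' : I → I → ℝ} {c c' : ℝ}
    (h : HasIteratedRSIntegral k R R' c) (h' : HasIteratedRSIntegral k' R R' c') :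
    HasIteratedRSIntegral (fun s t u v => k s t u v + k' s t u v) R R' (c + c') := by
  obtain ⟨F, h1, h2⟩ := h
  obtain ⟨F', h1', h2'⟩ := h'
  exact ⟨fun u v => F u v + F' u v, fun u v => (h1 u v).add (h1' u v), h2.add h2'⟩

lemma HasIteratedRSIntegral.const_mul {k : I → I → I → I → ℝ} {R R' : I → I → ℝ} {c : ℝ}
    (h : HasIteratedRSIntegral k R R' c) (x : ℝ) :
    HasIteratedRSIntegral (fun s t u v => x * k s t u v) R R' (x * c) := by
  obtain ⟨F, h1, h2⟩ := h
  exact ⟨fun u v => x * F u v, fun u v => (h1 u v).const_mul x, h2.const_mul x⟩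

/-- The step functions `g` for which the inner product of `F` with `g` is given by the iterated
integrals of the Lévy kernel against `g`. -/
def levyPairing {R : Fin 2 → CovKernel} (F : HSq R) : Submodule ℝ (StepSq R) where
  carrier := {g | ∃ c : Fin 2 → Fin 2 → ℝ,
    (∀ i j, HasIteratedRSIntegral (fun s t u v => levyKernel i j s u * StepSq.eval g i j t v)
      (R i).toFun (R j).toFun (c i j)) ∧
    inner ℝ F (StepSq.toHSq g) = ∑ i, ∑ j, c i j}
  zero_mem' := by
    refine ⟨fun _ _ => 0, fun i j => ?_, by simp⟩
    simpa using hasIteratedRSIntegral_zero (R i).toFun (R j).toFun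
  add_mem' := by
    rintro g g' ⟨c, h1, h2⟩ ⟨c', h1', h2'⟩
    refine ⟨fun i j => c i j + c' i j, fun i j => ?_, ?_⟩
    · simpa [mul_add] using (h1 i j).add (h1' i j)
    · simp [inner_add_right, h2, h2', Finset.sum_add_distrib]
  smul_mem' := by
    rintro x g ⟨c, h1, h2⟩
    refine ⟨fun i j => x * c i j, fun i j => ?_, ?_⟩
    · simpa [mul_left_comm] using (h1 i j).const_mul x
    · simp only [map_smul, real_inner_smul_right, h2, Finset.mul_sum]

lemma span_pairInd (R : Fin 2 → CovKernel) :
    Submodule.span ℝ (Set.range fun x : Fin 2 × I => pairInd R x.1 0 x.2) = ⊤ := by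
  set S := Submodule.span ℝ (Set.range fun x : Fin 2 × I => pairInd R x.1 0 x.2) with hS
  let single (i : Fin 2) : StepFun →ₗ[ℝ] StepPair R := LinearMap.single ℝ (fun _ => StepFun) i
  have h1 : ∀ (i : Fin 2) (φ : StepFun), single i φ ∈ S := by
    rintro i ⟨φ, hφ⟩
    have hφ' := hφ
    rw [stepFun_eq] at hφ'
    have h2 : ∀ ψ ∈ Submodule.span ℝ (Set.range iocBasis),
        ∃ hψ : ψ ∈ StepFun, single i ⟨ψ, hψ⟩ ∈ S := by
      intro ψ hψ
      induction hψ using Submodule.span_induction with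
      | mem ψ h =>
        obtain ⟨t, rfl⟩ := h
        exact ⟨(stepInd 0 t.1).2, Submodule.subset_span ⟨(i, t.1), rfl⟩⟩
      | zero => exact ⟨Submodule.zero_mem _, by
          have : (⟨0, Submodule.zero_mem _⟩ : StepFun) = 0 := rfl
          rw [this, map_zero]
          exact Submodule.zero_mem _⟩
      | add ψ ψ' _ _ h h' =>
        obtain ⟨h, hs⟩ := h
        obtain ⟨h', hs'⟩ := h'
        refine ⟨Submodule.add_mem _ h h', ?_⟩
        have := Submodule.add_mem _ hs hs'
        rwa [← map_add] at this
      | smul x ψ _ h =>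
        obtain ⟨h, hs⟩ := h
        refine ⟨Submodule.smul_mem _ x h, ?_⟩
        have := Submodule.smul_mem _ x hs
        rwa [← map_smul] at this
    exact (h2 φ hφ').2
  rw [eq_top_iff]
  intro f _
  have e : f = ∑ i : Fin 2, single i (f i) :=
    (Finset.univ_sum_single (M := fun _ : Fin 2 => StepFun) f).symm
  rw [e]
  exact Submodule.sum_mem _ fun i _ => h1 i _

lemma eval_pairInd_tmul {R : Fin 2 → CovKernel} (i₀ j₀ i j : Fin 2) (b d s t : I) :
    StepSq.eval (pairInd R i₀ 0 b ⊗ₜ[ℝ] pairInd R j₀ 0 d) i j s t =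
      if i = i₀ ∧ j = j₀ then ioc 0 b s * ioc 0 d t else 0 := by
  change ((pairInd R i₀ 0 b i : StepFun) : I → ℝ) s *
    ((pairInd R j₀ 0 d j : StepFun) : I → ℝ) t = _
  by_cases hi : i = i₀
  · by_cases hj : j = j₀
    · subst hi hj
      rw [pairInd_same, pairInd_same]
      simp [stepInd]
    · rw [pairInd_ne R hj]
      simp [hj]
  · rw [pairInd_ne R hi]
    simp [hi]

/-- The limit of the dyadic approximations pairs with all step functions through the iterated
integrals of the Lévy kernel. -/
lemma levyPairing_eq_top {R : Fin 2 → CovKernel} {p q : ℝ} (hp : 1 ≤ p) (hq : 1 ≤ q)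
    (hpq : 1 < p⁻¹ + q⁻¹) (hc : ∀ i, Continuous fun z : I × I => (R i).toFun z.1 z.2) {K L : ℝ}
    (hK : 0 < K) (hL : 0 < L) (h₀ : VarLE (R 0).toFun p K) (h₁ : VarLE (R 1).toFun q L)
    {F : HSq R} (hF : Tendsto (fun n : ℕ => StepSq.toHSq (levyStep R n)) atTop (𝓝 F)) :
    levyPairing F = ⊤ := by
  have hbasis : ∀ (i₀ j₀ : Fin 2) (b d : I),
      pairInd R i₀ 0 b ⊗ₜ[ℝ] pairInd R j₀ 0 d ∈ levyPairing F := by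
    intro i₀ j₀ b d
    have h0 : ∀ x : I, (0 : I) ≤ x := fun x => unitInterval.nonneg'
    set g : StepSq R := pairInd R i₀ 0 b ⊗ₜ[ℝ] pairInd R j₀ 0 d with hg
    have hlim : Tendsto (fun n => levyForm n (potential 0 (pairInd R i₀ 0 b))
        (potential 1 (pairInd R j₀ 0 d)) - levyForm n (potential 1 (pairInd R i₀ 0 b))
        (potential 0 (pairInd R j₀ 0 d))) atTop (𝓝 (inner ℝ F (StepSq.toHSq g))) := by
      have := hF.inner (𝕜 := ℝ) (tendsto_const_nhds (x := StepSq.toHSq g))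
      simpa only [hg, inner_toHSq_levyStep_tmul] using this
    have hz : ∀ n (y : I → ℝ), levyForm n y 0 = 0 := fun n y => by
      rw [levyForm_swap, levyForm_zero_left, neg_zero]
    -- only the pair of indices `(i₀, j₀)` contributes
    have hmain : HasIteratedRSIntegral
        (fun s t u v => levyKernel i₀ j₀ s u * (ioc 0 b t * ioc 0 d v))
        (R i₀).toFun (R j₀).toFun (inner ℝ F (StepSq.toHSq g)) := by
      have hne : (1 : Fin 2) ≠ 0 := by decide
      have same : ∀ i : Fin 2, inner ℝ F (StepSq.toHSq g) = 0 → HasIteratedRSIntegral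
          (fun s t u v => levyKernel i i s u * (ioc 0 b t * ioc 0 d v))
          (R i).toFun (R i).toFun (inner ℝ F (StepSq.toHSq g)) := by
        intro i hi
        simpa [levyKernel_same, hi] using hasIteratedRSIntegral_zero (R i).toFun (R i).toFun
      obtain rfl | rfl : i₀ = 0 ∨ i₀ = 1 := by fin_cases i₀ <;> simp
      · obtain rfl | rfl : j₀ = 0 ∨ j₀ = 1 := by fin_cases j₀ <;> simp
        · refine same 0 (tendsto_nhds_unique hlim ?_)
          simp only [potential_pairInd_ne hne, levyForm_zero_left, hz, sub_self]
          exact tendsto_const_nhds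
        · simp only [potential_pairInd_ne hne, levyForm_zero_left, sub_zero,
            potential_pairInd_same _ (h0 _)] at hlim
          exact hasIteratedRSIntegral_levyKernel_mul_ioc hp hq hpq (hc 0) (hc 1) hK hL h₀ h₁ b d
            hlim
      · obtain rfl | rfl : j₀ = 0 ∨ j₀ = 1 := by fin_cases j₀ <;> simp
        · simp only [potential_pairInd_ne hne.symm, levyForm_zero_left, zero_sub,
            potential_pairInd_same _ (h0 _)] at hlim
          have hlim' := hlim.neg
          simp only [neg_neg] at hlim'
          have := (hasIteratedRSIntegral_levyKernel_mul_ioc hq hp (by rwa [add_comm]) (hc 1) (hc 0)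
            hL hK h₁ h₀ b d hlim').const_mul (-1)
          simpa [levyKernel_one_zero] using this
        · refine same 1 (tendsto_nhds_unique hlim ?_)
          simp only [potential_pairInd_ne hne.symm, levyForm_zero_left, hz, sub_self]
          exact tendsto_const_nhds
    refine ⟨fun i j => if i = i₀ ∧ j = j₀ then inner ℝ F (StepSq.toHSq g) else 0,
      fun i j => ?_, ?_⟩
    · simp only [hg, eval_pairInd_tmul]
      by_cases h : i = i₀ ∧ j = j₀
      · obtain ⟨rfl, rfl⟩ := h
        simpa using hmain
      · simpa [h] using hasIteratedRSIntegral_zero (R i).toFun (R j).toFun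
    · rw [Finset.sum_eq_single i₀, Finset.sum_eq_single j₀]
      · simp
      · intro j _ hj
        simp [hj]
      · simp
      · intro i _ hi
        simp [hi]
      · simp
  -- extension by linearity in both factors
  have h1 : ∀ (i₀ : Fin 2) (b : I) (f' : StepPair R),
      pairInd R i₀ 0 b ⊗ₜ[ℝ] f' ∈ levyPairing F := by
    intro i₀ b f'
    have hle : Submodule.span ℝ (Set.range fun x : Fin 2 × I => pairInd R x.1 0 x.2) ≤
        (levyPairing F).comap (TensorProduct.mk ℝ _ _ (pairInd R i₀ 0 b)) := by
      rw [Submodule.span_le]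
      rintro _ ⟨⟨j₀, d⟩, rfl⟩
      exact hbasis i₀ j₀ b d
    rw [span_pairInd] at hle
    exact hle (Submodule.mem_top (x := f'))
  have h2 : ∀ f f' : StepPair R, f ⊗ₜ[ℝ] f' ∈ levyPairing F := by
    intro f f'
    have hle : Submodule.span ℝ (Set.range fun x : Fin 2 × I => pairInd R x.1 0 x.2) ≤
        (levyPairing F).comap ((TensorProduct.mk ℝ _ _).flip f') := by
      rw [Submodule.span_le]
      rintro _ ⟨⟨i₀, b⟩, rfl⟩
      exact h1 i₀ b f'
    rw [span_pairInd] at hle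
    exact hle (Submodule.mem_top (x := f))
  rw [eq_top_iff]
  intro g _
  induction g using TensorProduct.induction_on with
  | zero => exact Submodule.zero_mem _
  | tmul f f' => exact h2 f f'
  | add g g' h h' => exact Submodule.add_mem _ (h Submodule.mem_top) (h' Submodule.mem_top)

/-! ### Moments of Gaussian variables -/

lemma integral_pow_four_gaussianReal (v : NNReal) :
    ∫ x, x ^ 4 ∂(gaussianReal 0 v) = 3 * (v : ℝ) ^ 2 := by
  have h := iteratedDeriv_mgf_zero (X := id) (μ := gaussianReal 0 v) (by simp) 4
  -- the derivatives of the moment generating function are polynomials times an exponential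
  have hd : ∀ a b c : ℝ → ℝ, (∀ t, HasDerivAt a (b t) t) → (∀ t, c t = b t + a t * (v * t)) →
      deriv (fun t => a t * Real.exp (v * t ^ 2 / 2)) =
        fun t => c t * Real.exp (v * t ^ 2 / 2) := by
    intro a b c hab hc
    funext t
    have h1 : HasDerivAt (fun t : ℝ => Real.exp (v * t ^ 2 / 2))
        (Real.exp (v * t ^ 2 / 2) * (v * t)) t :=
      ((((hasDerivAt_pow 2 t).const_mul (v : ℝ)).div_const 2).congr_deriv (by
        push_cast
        ring)).exp
    rw [((hab t).fun_mul h1).deriv, hc]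
    ring
  have e0 : mgf id (gaussianReal 0 v) = fun t => 1 * Real.exp (v * t ^ 2 / 2) := by
    rw [mgf_id_gaussianReal]
    funext t
    simp
  have e1 := hd (fun _ => 1) (fun _ => 0) (fun t => v * t) (fun t => hasDerivAt_const t 1)
    (fun t => by ring)
  have e2 := hd (fun t => v * t) (fun _ => v) (fun t => v + v ^ 2 * t ^ 2)
    (fun t => ((hasDerivAt_id t).const_mul (v : ℝ)).congr_deriv (mul_one _)) (fun t => by ring)
  have e3 := hd (fun t => v + v ^ 2 * t ^ 2) (fun t => 2 * v ^ 2 * t)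
    (fun t => 3 * v ^ 2 * t + v ^ 3 * t ^ 3)
    (fun t => (((hasDerivAt_pow 2 t).const_mul ((v : ℝ) ^ 2)).const_add (v : ℝ)).congr_deriv (by
      push_cast
      ring)) (fun t => by ring)
  have e4 := hd (fun t => 3 * v ^ 2 * t + v ^ 3 * t ^ 3) (fun t => 3 * v ^ 2 + 3 * v ^ 3 * t ^ 2)
    (fun t => 3 * v ^ 2 + 6 * v ^ 3 * t ^ 2 + v ^ 4 * t ^ 4)
    (fun t => (((hasDerivAt_id t).const_mul (3 * (v : ℝ) ^ 2)).fun_add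
      ((hasDerivAt_pow 3 t).const_mul ((v : ℝ) ^ 3))).congr_deriv (by
        push_cast
        ring)) (fun t => by ring)
  rw [e0, iteratedDeriv_succ, iteratedDeriv_succ, iteratedDeriv_succ, iteratedDeriv_one, e1, e2, e3,
    e4] at h
  simpa using h.symm

lemma integral_sq_gaussianReal (v : NNReal) : ∫ x, x ^ 2 ∂(gaussianReal 0 v) = v := by
  have h := variance_fun_id_gaussianReal (μ := 0) (v := v)
  rw [variance_of_integral_eq_zero (by fun_prop) (by simp)] at h
  exact h

section Wick

variable {Ω : Type*} [MeasurableSpace Ω] {P : Measure Ω}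
  {V : Type*} [SeminormedAddCommGroup V] [InnerProductSpace ℝ V]

/-- A linear map into the random variables is isonormal if its values are centered Gaussian, with
variances given by the norm. -/
def IsIsonormal (P : Measure Ω) (W : V →ₗ[ℝ] (Ω → ℝ)) : Prop :=
  ∀ f, HasGaussianLaw (W f) P ∧ ∫ ω, W f ω ∂P = 0 ∧ Var[W f; P] = inner ℝ f f

variable {W : V →ₗ[ℝ] (Ω → ℝ)}

lemma IsIsonormal.memLp_four (hW : IsIsonormal P W) (f : V) : MemLp (W f) 4 P :=
  (hW f).1.memLp (by norm_num)

lemma IsIsonormal.memLp_two (hW : IsIsonormal P W) (f : V) : MemLp (W f) 2 P :=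
  (hW f).1.memLp_two

lemma IsIsonormal.memLp_mul (hW : IsIsonormal P W) (f g : V) : MemLp (W f * W g) 2 P := by
  have : ENNReal.HolderTriple 4 4 2 := ⟨by
    rw [← two_mul, show (4 : ℝ≥0∞) = 2 * 2 by norm_num,
      ENNReal.mul_inv (Or.inl (by norm_num)) (Or.inl (by norm_num)), ← mul_assoc,
      ENNReal.mul_inv_cancel (by norm_num) (by norm_num), one_mul]⟩
  exact (hW.memLp_four g).mul (hW.memLp_four f)

lemma IsIsonormal.map_eq (hW : IsIsonormal P W) (f : V) :
    P.map (W f) = gaussianReal 0 (inner ℝ f f : ℝ).toNNReal := by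
  rw [(hW f).1.map_eq_gaussianReal, (hW f).2.1, (hW f).2.2]

lemma IsIsonormal.integral_sq (hW : IsIsonormal P W) (f : V) :
    ∫ ω, W f ω ^ 2 ∂P = inner ℝ f f := by
  have h := integral_map (hW f).1.aemeasurable (f := fun x : ℝ => x ^ 2)
    (by fun_prop : Continuous fun x : ℝ => x ^ 2).aestronglyMeasurable
  rw [← h, hW.map_eq, integral_sq_gaussianReal, Real.coe_toNNReal _ real_inner_self_nonneg]

lemma IsIsonormal.integral_pow_four (hW : IsIsonormal P W) (f : V) :
    ∫ ω, W f ω ^ 4 ∂P = 3 * (inner ℝ f f : ℝ) ^ 2 := by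
  have h := integral_map (hW f).1.aemeasurable (f := fun x : ℝ => x ^ 4)
    (by fun_prop : Continuous fun x : ℝ => x ^ 4).aestronglyMeasurable
  rw [← h, hW.map_eq, integral_pow_four_gaussianReal, Real.coe_toNNReal _ real_inner_self_nonneg]

lemma IsIsonormal.integrable_sq (hW : IsIsonormal P W) (f : V) :
    Integrable (fun ω => W f ω ^ 2) P :=
  (hW.memLp_two f).integrable_sq

lemma IsIsonormal.integrable_pow_four (hW : IsIsonormal P W) (f : V) :
    Integrable (fun ω => W f ω ^ 4) P := by
  have h := (hW.memLp_mul f f).integrable_sq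
  refine h.congr (Eventually.of_forall fun ω => ?_)
  simp only [Pi.mul_apply]
  ring

lemma IsIsonormal.integral_mul (hW : IsIsonormal P W) (f g : V) :
    ∫ ω, W f ω * W g ω ∂P = inner ℝ f g := by
  have e : (fun ω => W f ω * W g ω) =
      fun ω => 1 / 4 * (W (f + g) ω ^ 2 - W (f - g) ω ^ 2) := by
    funext ω
    simp only [map_add, map_sub, Pi.add_apply, Pi.sub_apply]
    ring
  rw [e, integral_const_mul, integral_sub (hW.integrable_sq _) (hW.integrable_sq _),
    hW.integral_sq, hW.integral_sq]
  simp only [inner_add_left, inner_add_right, inner_sub_left, inner_sub_right]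
  rw [real_inner_comm f g]
  ring

/-- Wick's formula for four factors, by polarization of the fourth moment. -/
lemma IsIsonormal.integral_mul_mul_mul (hW : IsIsonormal P W) (a b c d : V) :
    ∫ ω, (W a ω * W b ω) * (W c ω * W d ω) ∂P =
      inner ℝ a b * inner ℝ c d + inner ℝ a c * inner ℝ b d + inner ℝ a d * inner ℝ b c := by
  have e : (fun ω => (W a ω * W b ω) * (W c ω * W d ω)) = fun ω => 1 / 192 *
      (W (a + b + c + d) ω ^ 4 - W (a + b + c - d) ω ^ 4 - W (a + b - c + d) ω ^ 4
        + W (a + b - c - d) ω ^ 4 - W (a - b + c + d) ω ^ 4 + W (a - b + c - d) ω ^ 4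
        + W (a - b - c + d) ω ^ 4 - W (a - b - c - d) ω ^ 4) := by
    funext ω
    simp only [map_add, map_sub, Pi.add_apply, Pi.sub_apply]
    ring
  have hi := hW.integrable_pow_four
  rw [e, integral_const_mul, integral_sub (by fun_prop) (by fun_prop),
    integral_add (by fun_prop) (by fun_prop), integral_add (by fun_prop) (by fun_prop),
    integral_sub (by fun_prop) (by fun_prop), integral_add (by fun_prop) (by fun_prop),
    integral_sub (by fun_prop) (by fun_prop), integral_sub (by fun_prop) (by fun_prop)]
  simp only [hW.integral_pow_four]
  simp only [inner_add_left, inner_add_right, inner_sub_left, inner_sub_right]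
  rw [real_inner_comm a b, real_inner_comm a c, real_inner_comm a d, real_inner_comm b c,
    real_inner_comm b d, real_inner_comm c d]
  ring

end Wick

lemma norm_toLp_sq {Ω : Type*} [MeasurableSpace Ω] {P : Measure Ω} {f : Ω → ℝ}
    (hf : MemLp f 2 P) : ‖hf.toLp f‖ ^ 2 = ∫ ω, f ω ^ 2 ∂P := by
  rw [← real_inner_self_eq_norm_sq, L2.inner_def]
  refine integral_congr_ae ?_
  filter_upwards [hf.coeFn_toLp] with ω h
  rw [h]
  simp [sq]

/-! ### The Wiener integral is isonormal -/

/-- The coefficients of the elementary integral of a step function with respect to the values of the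
integrator. -/
noncomputable def stepWeights (φ : StepFun) : I →₀ ℝ :=
  (stepCoeff φ).mapDomain Subtype.val - Finsupp.single 0 ((stepCoeff φ).sum fun _ x => x)

lemma stepInt_eq_linearCombination {V : Type*} [AddCommGroup V] [Module ℝ V] (G : I → V)
    (φ : StepFun) : stepInt G φ = Finsupp.linearCombination ℝ G (stepWeights φ) := by
  rw [stepWeights, map_sub, Finsupp.linearCombination_mapDomain, Finsupp.linearCombination_single]
  simp only [stepInt, LinearMap.comp_apply, Finsupp.linearCombination_apply, Finsupp.sum, smul_sub,
    Finset.sum_sub_distrib, Finset.sum_smul, Function.comp_apply]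

lemma stepInt_process_eq {Ω : Type*} (Y : I → Ω → ℝ) (φ : StepFun) :
    stepInt Y φ = fun ω => ∑ t ∈ (stepWeights φ).support, stepWeights φ t * Y t ω := by
  rw [stepInt_eq_linearCombination]
  funext ω
  simp [Finsupp.linearCombination_apply, Finsupp.sum]

lemma doubleWienerStep_tmul {Ω : Type*} (R : Fin 2 → CovKernel) (X : Fin 2 → I → Ω → ℝ)
    (f g : StepPair R) :
    doubleWienerStep R X (f ⊗ₜ[ℝ] g) =
      fun ω => wienerStep R X f ω * wienerStep R X g ω - inner ℝ f g := rfl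

section WienerIntegral

variable {Ω : Type*} [MeasurableSpace Ω] {P : Measure Ω}

lemma hasGaussianLaw_stepInt {Y : I → Ω → ℝ} (hY : IsGaussianProcess Y P) (φ : StepFun) :
    HasGaussianLaw (stepInt Y φ) P := by
  rw [stepInt_process_eq]
  exact (hY.smul (stepWeights φ)).hasGaussianLaw_fun_sum

lemma integral_stepInt {Y : I → Ω → ℝ} (hY : IsGaussianProcess Y P)
    (h0 : ∀ t, ∫ ω, Y t ω ∂P = 0) (φ : StepFun) : ∫ ω, stepInt Y φ ω ∂P = 0 := by
  rw [stepInt_process_eq, integral_finsetSum]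
  · simp [integral_const_mul, h0]
  · intro t _
    exact (hY.hasGaussianLaw_eval t).integrable.const_mul _

lemma variance_stepInt [IsProbabilityMeasure P] {Y : I → Ω → ℝ} (hY : IsGaussianProcess Y P)
    (φ : StepFun) : Var[stepInt Y φ; P] = stepForm (covKernel P Y hY) φ φ := by
  rw [stepInt_process_eq, variance_fun_sum'
    (fun t _ => (hY.hasGaussianLaw_eval t).memLp_two.const_mul _), stepForm,
    stepInt_eq_linearCombination]
  simp only [stepInt_eq_linearCombination, Finsupp.linearCombination_apply, Finsupp.sum,
    smul_eq_mul, Finset.mul_sum]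
  refine Finset.sum_congr rfl fun s _ => Finset.sum_congr rfl fun t _ => ?_
  rw [covariance_const_mul_left, covariance_const_mul_right]
  rfl

lemma isIsonormal_wienerStep [IsProbabilityMeasure P] {X : Fin 2 → I → Ω → ℝ}
    (hX : ∀ i, IsGaussianProcess (X i) P)
    (h0 : ∀ i t, ∫ ω, X i t ω ∂P = 0)
    (hindep : IndepFun (fun ω t => X 0 t ω) (fun ω t => X 1 t ω) P) :
    IsIsonormal P (wienerStep (fun i => covKernel P (X i) (hX i)) X) := by
  intro f
  have e : wienerStep (fun i => covKernel P (X i) (hX i)) X f =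
      stepInt (X 0) (f 0) + stepInt (X 1) (f 1) := by
    simp only [wienerStep, Fin.sum_univ_two]
    rfl
  have hm : ∀ φ : StepFun, Measurable fun y : I → ℝ =>
      ∑ t ∈ (stepWeights φ).support, stepWeights φ t * y t := fun φ => by fun_prop
  have hind : IndepFun (stepInt (X 0) (f 0)) (stepInt (X 1) (f 1)) P := by
    rw [stepInt_process_eq, stepInt_process_eq]
    exact hindep.comp (hm (f 0)) (hm (f 1))
  have hg0 := hasGaussianLaw_stepInt (hX 0) (f 0)
  have hg1 := hasGaussianLaw_stepInt (hX 1) (f 1)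
  rw [e]
  refine ⟨iIndepFun.hasGaussianLaw_add hg0 hg1 hind, ?_, ?_⟩
  · simp only [Pi.add_apply]
    rw [integral_add hg0.integrable hg1.integrable, integral_stepInt (hX 0) (h0 0),
      integral_stepInt (hX 1) (h0 1), add_zero]
  · rw [hind.variance_add hg0.memLp_two hg1.memLp_two, variance_stepInt, variance_stepInt,
      inner_stepPair, Fin.sum_univ_two]

/-! ### Continuity of the covariance function -/

/-- For centered Gaussian processes, almost sure continuity of the paths implies continuity in mean
square: the characteristic functions of the increments converge, hence so do their variances. -/
lemma tendsto_variance_sub [IsProbabilityMeasure P] {Y : I → Ω → ℝ} (hY : IsGaussianProcess Y P)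
    (h0 : ∀ t, ∫ ω, Y t ω ∂P = 0) (hc : ∀ᵐ ω ∂P, Continuous fun t => Y t ω) (t₀ : I) :
    Tendsto (fun t => Var[fun ω => Y t ω - Y t₀ ω; P]) (𝓝 t₀) (𝓝 0) := by
  refine tendsto_of_seq_tendsto fun t ht => ?_
  have hg : ∀ n, HasGaussianLaw (fun ω => Y (t n) ω - Y t₀ ω) P := fun n =>
    hY.hasGaussianLaw_fun_sub
  have hchar : ∀ n, ‖∫ ω, Complex.exp (((Y (t n) ω - Y t₀ ω : ℝ) : ℂ) * Complex.I) ∂P‖ =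
      Real.exp (-(Var[fun ω => Y (t n) ω - Y t₀ ω; P] / 2)) := by
    intro n
    have h1 := (hg n).charFun_map_eq (1 : ℝ)
    rw [charFun_apply_real, integral_map (hg n).aemeasurable
      (by fun_prop : Continuous fun x : ℝ =>
        Complex.exp (((1 : ℝ) : ℂ) * (x : ℂ) * Complex.I)).aestronglyMeasurable] at h1
    have h2 : ∫ ω, Y (t n) ω - Y t₀ ω ∂P = 0 := by
      rw [integral_sub (hY.hasGaussianLaw_eval _).integrable (hY.hasGaussianLaw_eval _).integrable,
        h0, h0, sub_zero]
    simp only [Complex.ofReal_one, one_mul, RCLike.inner_apply, conj_trivial, mul_one, h2,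
      Complex.ofReal_zero, zero_mul, zero_sub] at h1
    rw [h1, Complex.norm_exp]
    congr 1
    simp [← Complex.ofReal_ofNat, ← Complex.ofReal_div]
  have hlim : Tendsto (fun n => ∫ ω, Complex.exp (((Y (t n) ω - Y t₀ ω : ℝ) : ℂ) * Complex.I) ∂P)
      atTop (𝓝 (∫ _, (1 : ℂ) ∂P)) := by
    refine tendsto_integral_of_dominated_convergence (fun _ => 1) (fun n => ?_)
      (integrable_const _) (fun n => ?_) ?_
    · exact (by fun_prop : Continuous fun x : ℝ =>
        Complex.exp ((x : ℂ) * Complex.I)).comp_aestronglyMeasurable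
          (hg n).aemeasurable.aestronglyMeasurable
    · exact Eventually.of_forall fun ω => by rw [Complex.norm_exp_ofReal_mul_I]
    · filter_upwards [hc] with ω hω
      have h1 : Tendsto (fun n => Y (t n) ω) atTop (𝓝 (Y t₀ ω)) := (hω.tendsto t₀).comp ht
      have h2 : Tendsto (fun n => Y (t n) ω - Y t₀ ω) atTop (𝓝 0) := by
        simpa using h1.sub_const (Y t₀ ω)
      have h3 := ((by fun_prop : Continuous fun x : ℝ =>
        Complex.exp ((x : ℂ) * Complex.I)).tendsto 0).comp h2
      simpa [Function.comp_def] using h3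
  have h1 := hlim.norm
  simp only [hchar, integral_const, probReal_univ, one_smul, norm_one] at h1
  have h2 := (h1.log one_ne_zero).const_mul (-2)
  simp only [Real.log_exp, Real.log_one, mul_zero] at h2
  refine h2.congr fun n => ?_
  simp only [Function.comp_apply]
  ring

lemma continuous_covKernel [IsProbabilityMeasure P] {Y : I → Ω → ℝ} (hY : IsGaussianProcess Y P)
    (h0 : ∀ t, ∫ ω, Y t ω ∂P = 0) (hc : ∀ᵐ ω ∂P, Continuous fun t => Y t ω) :
    Continuous fun z : I × I => (covKernel P Y hY).toFun z.1 z.2 := by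
  have hL : ∀ t, MemLp (Y t) 2 P := fun t => (hY.hasGaussianLaw_eval t).memLp_two
  -- the process as a curve in `L²`
  let y : I → Lp ℝ 2 P := fun t => (hL t).toLp (Y t)
  have hy : Continuous y := by
    rw [continuous_iff_continuousAt]
    intro t₀
    rw [ContinuousAt, tendsto_iff_norm_sub_tendsto_zero]
    have h1 : ∀ t, ‖y t - y t₀‖ ^ 2 = Var[fun ω => Y t ω - Y t₀ ω; P] := by
      intro t
      have h2 : y t - y t₀ = ((hL t).sub (hL t₀)).toLp (Y t - Y t₀) := (MemLp.toLp_sub _ _).symm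
      rw [h2, norm_toLp_sq, variance_of_integral_eq_zero]
      · rfl
      · exact ((hL t).sub (hL t₀)).aestronglyMeasurable.aemeasurable
      · rw [integral_sub ((hL t).integrable (by norm_num)) ((hL t₀).integrable (by norm_num)),
          h0, h0, sub_zero]
    have h2 := (tendsto_variance_sub hY h0 hc t₀).sqrt
    simp only [← h1, Real.sqrt_zero] at h2
    exact h2.congr fun t => Real.sqrt_sq (norm_nonneg _)
  have e : (fun z : I × I => (covKernel P Y hY).toFun z.1 z.2) =
      fun z : I × I => inner ℝ (y z.1) (y z.2) := by
    funext z
    change cov[Y z.1, Y z.2; P] = _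
    rw [covariance_eq_sub (hL _) (hL _), h0, zero_mul, sub_zero, L2.inner_def]
    refine integral_congr_ae ?_
    filter_upwards [(hL z.1).coeFn_toLp, (hL z.2).coeFn_toLp] with ω h1 h2
    simp only [y]
    rw [h1, h2]
    simp [mul_comm]
  rw [e]
  exact (hy.comp continuous_fst).inner (hy.comp continuous_snd)

/-! ### The double Wiener–Itô integral -/

variable {R : Fin 2 → CovKernel} {X : Fin 2 → I → Ω → ℝ}

lemma memLp_doubleWienerStep [IsProbabilityMeasure P] (hW : IsIsonormal P (wienerStep R X))
    (u : StepSq R) : MemLp (doubleWienerStep R X u) 2 P := by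
  induction u using TensorProduct.induction_on with
  | zero =>
    rw [map_zero]
    exact MemLp.zero
  | tmul f g => exact (hW.memLp_mul f g).sub (memLp_const (inner ℝ f g))
  | add u v hu hv =>
    rw [map_add]
    exact hu.add hv

/-- The Itô isometry for the double integral: `I₂` annihilates antisymmetric tensors. -/
lemma integral_doubleWienerStep_mul [IsProbabilityMeasure P]
    (hW : IsIsonormal P (wienerStep R X)) (u v : StepSq R) :
    ∫ ω, doubleWienerStep R X u ω * doubleWienerStep R X v ω ∂P =
      inner ℝ (StepSq.toHSq u) (StepSq.toHSq v) +
        inner ℝ (StepSq.toHSq u) (StepSq.toHSq (TensorProduct.comm ℝ _ _ v)) := by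
  have hL := memLp_doubleWienerStep hW
  have hint : ∀ u v : StepSq R,
      Integrable (fun ω => doubleWienerStep R X u ω * doubleWienerStep R X v ω) P :=
    fun u v => (hL u).integrable_mul (hL v)
  induction u using TensorProduct.induction_on with
  | zero => simp
  | add u u' hu hu' =>
    simp only [map_add, Pi.add_apply, add_mul, inner_add_left]
    rw [integral_add (hint _ _) (hint _ _), hu, hu']
    ring
  | tmul f g =>
    induction v using TensorProduct.induction_on with
    | zero => simp
    | add v v' hv hv' =>
      simp only [map_add, Pi.add_apply, mul_add, inner_add_right]
      rw [integral_add (hint _ _) (hint _ _), hv, hv']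
      ring
    | tmul f' g' =>
      have hi2 : ∀ a b : StepPair R,
          Integrable (fun ω => wienerStep R X a ω * wienerStep R X b ω) P :=
        fun a b => (hW.memLp_two a).integrable_mul (hW.memLp_two b)
      have hi4 : Integrable (fun ω => (wienerStep R X f ω * wienerStep R X g ω) *
          (wienerStep R X f' ω * wienerStep R X g' ω)) P :=
        (hW.memLp_mul f g).integrable_mul (hW.memLp_mul f' g')
      have e : (fun ω => doubleWienerStep R X (f ⊗ₜ[ℝ] g) ω *
          doubleWienerStep R X (f' ⊗ₜ[ℝ] g') ω) = fun ω =>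
          (wienerStep R X f ω * wienerStep R X g ω) * (wienerStep R X f' ω * wienerStep R X g' ω) -
          inner ℝ f' g' * (wienerStep R X f ω * wienerStep R X g ω) -
          inner ℝ f g * (wienerStep R X f' ω * wienerStep R X g' ω) +
          inner ℝ f g * inner ℝ f' g' := by
        funext ω
        rw [doubleWienerStep_tmul, doubleWienerStep_tmul]
        ring
      have hfg := hi2 f g
      have hfg' := hi2 f' g'
      rw [e, integral_add (by fun_prop) (by fun_prop), integral_sub (by fun_prop) (by fun_prop),
        integral_sub (by fun_prop) (by fun_prop), integral_const_mul, integral_const_mul,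
        hW.integral_mul_mul_mul, hW.integral_mul, hW.integral_mul,
        TensorProduct.comm_tmul, inner_toHSq_tmul, inner_toHSq_tmul]
      simp
      ring

lemma norm_toHSq_comm (u : StepSq R) :
    ‖StepSq.toHSq (TensorProduct.comm ℝ (StepPair R) (StepPair R) u)‖ = ‖StepSq.toHSq u‖ := by
  have h : ∀ u v : StepSq R, (inner ℝ (StepSq.toHSq (TensorProduct.comm ℝ _ _ u))
      (StepSq.toHSq (TensorProduct.comm ℝ _ _ v)) : ℝ) =
        inner ℝ (StepSq.toHSq u) (StepSq.toHSq v) := by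
    intro u v
    induction u using TensorProduct.induction_on with
    | zero => simp
    | add u u' hu hu' => simp only [map_add, inner_add_left, hu, hu']
    | tmul f g =>
      induction v using TensorProduct.induction_on with
      | zero => simp
      | add v v' hv hv' => simp only [map_add, inner_add_right, hv, hv']
      | tmul f' g' =>
        rw [TensorProduct.comm_tmul, TensorProduct.comm_tmul, inner_toHSq_tmul, inner_toHSq_tmul,
          mul_comm]
  rw [norm_eq_sqrt_real_inner, norm_eq_sqrt_real_inner, h]

/-- The elementary double integral as a map into `L²`. -/
noncomputable def doubleWienerLp [IsProbabilityMeasure P]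
    (hW : IsIsonormal P (wienerStep R X)) (u : StepSq R) : Lp ℝ 2 P :=
  (memLp_doubleWienerStep hW u).toLp (doubleWienerStep R X u)

lemma norm_doubleWienerLp_sub_le [IsProbabilityMeasure P]
    (hW : IsIsonormal P (wienerStep R X)) (u v : StepSq R) :
    ‖doubleWienerLp hW u - doubleWienerLp hW v‖ ≤ 2 * ‖StepSq.toHSq u - StepSq.toHSq v‖ := by
  have e : doubleWienerLp hW u - doubleWienerLp hW v =
      (memLp_doubleWienerStep hW (u - v)).toLp (doubleWienerStep R X (u - v)) := by
    rw [doubleWienerLp, doubleWienerLp, ← MemLp.toLp_sub]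
    congr 1
    rw [map_sub]
  rw [← map_sub]
  refine (sq_le_sq₀ (norm_nonneg _) (by positivity)).1 ?_
  rw [e, norm_toLp_sq]
  have h := integral_doubleWienerStep_mul hW (u - v) (u - v)
  have h2 := real_inner_le_norm (StepSq.toHSq (u - v))
    (StepSq.toHSq (TensorProduct.comm ℝ (StepPair R) (StepPair R) (u - v)))
  rw [norm_toHSq_comm] at h2
  rw [real_inner_self_eq_norm_sq] at h
  simp only [sq] at h ⊢
  rw [h]
  nlinarith [norm_nonneg (StepSq.toHSq (u - v))]

/-- The double Wiener–Itô integral exists on the whole Hilbert tensor square. -/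
lemma exists_isDoubleWienerIntegral [IsProbabilityMeasure P]
    (hW : IsIsonormal P (wienerStep R X)) (F : HSq R) :
    ∃ A : Ω → ℝ, IsDoubleWienerIntegral P R X F A := by
  have hne : (comap (StepSq.toHSq : StepSq R → HSq R) (𝓝 F)).NeBot := by
    rw [comap_neBot_iff]
    intro t ht
    obtain ⟨x, hx, u, rfl⟩ := (mem_closure_iff_nhds.1 (denseRange_toHSq R F)) t ht
    exact ⟨u, hx⟩
  have hcauchy : Cauchy (map (doubleWienerLp hW) (comap StepSq.toHSq (𝓝 F))) := by
    rw [Metric.cauchy_iff]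
    refine ⟨inferInstance, fun ε hε => ?_⟩
    refine ⟨doubleWienerLp hW '' (StepSq.toHSq ⁻¹' Metric.ball F (ε / 4)),
      image_mem_map (preimage_mem_comap (Metric.ball_mem_nhds F (by positivity))), ?_⟩
    rintro _ ⟨u, hu, rfl⟩ _ ⟨v, hv, rfl⟩
    rw [dist_eq_norm]
    refine (norm_doubleWienerLp_sub_le hW u v).trans_lt ?_
    rw [← dist_eq_norm]
    have h1 : dist (StepSq.toHSq u) F < ε / 4 := hu
    have h2 : dist (StepSq.toHSq v) F < ε / 4 := hv
    have h3 := dist_triangle_right (StepSq.toHSq u) (StepSq.toHSq v) F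
    linarith
  obtain ⟨A, hA⟩ := CompleteSpace.complete hcauchy
  refine ⟨A, Lp.memLp A, ?_⟩
  have h1 : Tendsto (doubleWienerLp hW) (comap StepSq.toHSq (𝓝 F)) (𝓝 A) := hA
  rw [tendsto_iff_edist_tendsto_0] at h1
  refine h1.congr fun u => ?_
  rw [Lp.edist_def]
  exact eLpNorm_congr_ae ((memLp_doubleWienerStep hW u).coeFn_toLp.sub (ae_eq_refl _))

end WienerIntegral

end LevyArea

theorem mainTheorem1 {Ω : Type*} [MeasurableSpace Ω] (P : Measure Ω) [IsProbabilityMeasure P]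
    (X : Fin 2 → I → Ω → ℝ)
    (hgauss : ∀ i, IsGaussianProcess (X i) P)
    (hcentered : ∀ i t, ∫ ω, X i t ω ∂P = 0)
    (hcont : ∀ i, ∀ᵐ ω ∂P, Continuous fun t => X i t ω)
    (hzero : ∀ i, ∀ᵐ ω ∂P, X i 0 ω = 0)
    (hindep : IndepFun (fun ω t => X 0 t ω) (fun ω t => X 1 t ω) P)
    (R : Fin 2 → CovKernel) (hR : R = fun i => covKernel P (X i) (hgauss i))
    (p q : ℝ) (hp : 1 ≤ p) (hq : 1 ≤ q) (hpq : 1 < p⁻¹ + q⁻¹)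
    (hR₁ : pVariation (R 0).toFun p < ⊤) (hR₂ : pVariation (R 1).toFun q < ⊤) :
    CauchySeq (fun n : ℕ => StepSq.toHSq (levyStep R n)) ∧
    ∃ fhat : HSq R,
      Tendsto (fun n : ℕ => StepSq.toHSq (levyStep R n)) atTop (𝓝 fhat) ∧
      fhat ∈ HSym R ∧
      (∀ g : StepSq R, ∃ c : Fin 2 → Fin 2 → ℝ,
        (∀ i j, HasIteratedRSIntegral
          (fun s t u v => levyKernel i j s u * StepSq.eval g i j t v)
          (R i).toFun (R j).toFun (c i j)) ∧
        inner ℝ fhat (StepSq.toHSq g) = ∑ i, ∑ j, c i j) ∧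
      ∃ A : Ω → ℝ, IsDoubleWienerIntegral P R X fhat A := by
  subst hR
  set R : Fin 2 → CovKernel := fun i => covKernel P (X i) (hgauss i)
  have hc : ∀ i, Continuous fun z : I × I => (R i).toFun z.1 z.2 := fun i =>
    continuous_covKernel (hgauss i) (hcentered i) (hcont i)
  obtain ⟨K, hK, h₀⟩ := exists_varLE_of_pVariation_lt_top (by linarith) hR₁
  obtain ⟨L, hL, h₁⟩ := exists_varLE_of_pVariation_lt_top (by linarith) hR₂
  have hcauchy := cauchySeq_toHSq_levyStep hp hq hpq hc hK hL h₀ h₁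
  obtain ⟨fhat, hlim⟩ := cauchySeq_tendsto_of_complete hcauchy
  refine ⟨hcauchy, fhat, hlim, ?_, fun g => ?_, ?_⟩
  · exact (Submodule.isClosed_topologicalClosure _).mem_of_tendsto hlim
      (Eventually.of_forall fun n => toHSq_levyStep_mem_HSym R n)
  · have hg : g ∈ levyPairing fhat := by
      rw [levyPairing_eq_top hp hq hpq hc hK hL h₀ h₁ hlim]
      exact Submodule.mem_top
    exact hg
  · exact exists_isDoubleWienerIntegral (isIsonormal_wienerStep hgauss hcentered hindep) fhat
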